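/- Let $K$ be a local field of characteristic $p>0$ (a nondiscrete, locally compact, totally disconnected topological field), with ring of integers $\mathfrak D$, maximal ideal $\mathfrak P\subset\mathfrak D$, and residue field $\mathfrak D/\mathfrak P$ with $q=p^c$ elements. Fix a prime element $\mathfrak p$ (a generator of $\mathfrak P$) and elements $1=\epsilon_0,\epsilon_1,\dots,\epsilon_{c-1}\in\mathfrak D$ whose residue classes form a basis of $\mathfrak D/\mathfrak P$ over $GF(p)$. For $0\le n<q$ with base-$p$ expansion $n=a_0+a_1p+\dots+a_{c-1}p^{c-1}$, $0\le a_i<p$, put $u(n)=(a_0+a_1\epsilon_1+\dots+a_{c-1}\epsilon_{c-1})\mathfrak p^{-1}$; for an arbitrary integer $n\ge 0$ with base-$q$ expansion $n=b_0+b_1q+\dots+b_sq^s$, $0\le b_i<q$, put $u(n)=u(b_0)+u(b_1)\mathfrak p^{-1}+\dots+u(b_s)\mathfrak p^{-s}$. Let $L^2(K)$ be the space of complex square-integrable functions for the Haar measure on $K$ with $|\mathfrak D|=1$. For $j\in\mathbb Z$, $y\in K$ and $f\in L^2(K)$ let $\delta_jf(x)=q^{j/2}f(\mathfrak p^{-j}x)$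 and $\tau_yf(x)=f(x-y)$. Given a finite family $\Psi=(\psi^1,\dots,\psi^L)$ in $L^2(K)$, for $1\le l\le L$, $j\in\mathbb Z$ and $k\in\mathbb N_0$ let $$\psi^l_{j,k}=\delta_j\tau_{u(k)}\psi^l,\qquad \tilde\psi^l_{j,k}=\begin{cases}\delta_j\tau_{u(k)}\psi^l,& j\ge 0,\\ q^{j/2}\,\tau_{u(k)}\delta_j\psi^l,& j<0.\end{cases}$$ The affine system $X(\Psi)$ is the family $(\psi^l_{j,k})_{l,j,k}$ and the quasi-affine system $\tilde X(\Psi)$ is the family $(\tilde\psi^l_{j,k})_{l,j,k}$; both are indexed families, so elements are counted with multiplicity. A family $(\eta_i)_{i\in I}$ in $L^2(K)$ is a Bessel family if there is $B>0$ with $\sum_{i}|\langle f,\eta_i\rangle|^2\le B\|f\|^2$ for all $f\in L^2(K)$; the smallest $B\ge 0$ with this property is its optimal upper bound. It is a frame if there are $0<A\le B$ with $A\|f\|^2\le\sum_i|\langle f,\eta_i\rangle|^2\le B\|f\|^2$ for all $f\in L^2(K)$; the largest such $A$ is then its optimal lower bound. Then: (a) $X(\Psi)$ is a Bessel family if and only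 if $\tilde X(\Psi)$ is a Bessel family, and in that case their optimal upper bounds exist and are equal. (b) $X(\Psi)$ is a frame if and only if $\tilde X(\Psi)$ is a frame, and in that case their optimal lower bounds are equal and their optimal upper bounds are equal. -/

import Mathlib

open MeasureTheory ValuativeRel
open scoped ENNReal NNReal

noncomputable section

namespace LocalFieldFrames

/-! ### Bessel families and frames in a Hilbert space -/

section Frames

variable {ι H : Type*} [NormedAddCommGroup H] [InnerProductSpace ℂ H]

/-- `∑ i, |⟨f, η i⟩|²`, a sum of nonnegative terms with value in `[0, ∞]`. -/
def frameSum (η : ι → H) (f : H) : ℝ≥0∞ := ∑' i, ‖inner ℂ f (η i)‖ₑ ^ 2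

/-- `B` can be used as an upper bound: `∑ i, |⟨f, η i⟩|² ≤ B ‖f‖²` for all `f`. -/
def HasUpperBound (η : ι → H) (B : ℝ≥0) : Prop :=
  ∀ f : H, frameSum η f ≤ (B : ℝ≥0∞) * ‖f‖ₑ ^ 2

/-- `A` can be used as a lower bound: `A ‖f‖² ≤ ∑ i, |⟨f, η i⟩|²` for all `f`. -/
def HasLowerBound (η : ι → H) (A : ℝ≥0) : Prop :=
  ∀ f : H, (A : ℝ≥0∞) * ‖f‖ₑ ^ 2 ≤ frameSum η f

/-- The indexed family `η` is a Bessel family. -/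
def IsBesselFamily (η : ι → H) : Prop :=
  ∃ B : ℝ≥0, 0 < B ∧ HasUpperBound η B

/-- The indexed family `η` is a frame. -/
def IsFrame (η : ι → H) : Prop :=
  ∃ A B : ℝ≥0, 0 < A ∧ A ≤ B ∧ HasLowerBound η A ∧ HasUpperBound η B

/-- `B` is the smallest upper bound of `η`. -/
def IsOptimalUpperBound (η : ι → H) (B : ℝ≥0) : Prop :=
  IsLeast {B' : ℝ≥0 | HasUpperBound η B'} B

/-- `A` is the largest lower bound of `η`. -/
def IsOptimalLowerBound (η : ι → H) (A : ℝ≥0) : Prop :=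
  IsGreatest {A' : ℝ≥0 | HasLowerBound η A'} A

end Frames

/-! ### The translation set of a local field of characteristic `p` -/

section LocalField

variable (K : Type*) [Field K] [ValuativeRel K] [TopologicalSpace K]
  [IsNonarchimedeanLocalField K]

/-- The residue field of a field of characteristic `p` has characteristic `p`. -/
theorem charP_residueField (p : ℕ) [Fact p.Prime] [CharP K p] : CharP 𝓀[K] p := by
  refine (CharP.charP_iff_prime_eq_zero (Fact.out : p.Prime)).2 ?_
  have h1 : ((p : ℕ) : 𝒪[K]) = 0 := by
    apply Subtype.ext
    simp
  rw [← map_natCast (IsLocalRing.residue 𝒪[K]) p, h1, map_zero]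

theorem secondCountable : SecondCountableTopology K := by
  let := IsTopologicalAddGroup.rightUniformSpace K
  have := isUniformAddGroup_of_addCommGroup (G := K)
  have : Countable (WithZero (Multiplicative ℤ)) :=
    inferInstanceAs (Countable (Option ℤ))
  have : Countable (ValueGroupWithZero K) :=
    (IsNonarchimedeanLocalField.valueGroupWithZeroIsoInt K).toEquiv.injective.countable
  have : SigmaCompactSpace K := by
    refine ⟨?_⟩
    have h := isSigmaCompact_iUnion_of_isCompact
      (fun γ : ValueGroupWithZero K => {x : K | valuation K x ≤ γ})
      (fun γ => IsNonarchimedeanLocalField.isCompact_closedBall K γ)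
    convert h
    refine (Set.eq_univ_of_forall fun x => ?_).symm
    exact Set.mem_iUnion.2 ⟨valuation K x, (le_refl (valuation K x) :)⟩
  have : (nhds (0 : K)).IsCountablyGenerated :=
    (IsValuativeTopology.hasBasis_nhds_zero' K).isCountablyGenerated
  have : (uniformity K).IsCountablyGenerated :=
    IsUniformAddGroup.uniformity_countably_generated
  let := UniformSpace.pseudoMetricSpace K
  exact EMetric.secondCountable_of_sigmaCompact K

/-- The choices on which the translation set depends: a prime element `ϖ` of `K` (a generator of
the maximal ideal of the ring of integers `𝒪[K]`), and `1 = ε₀, ε₁, …, ε_{c-1}` in `𝒪[K]` whose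
residue classes are a basis of the residue field over the field with `p` elements. -/
structure Choices (p : ℕ) [Fact p.Prime] [CharP K p] where
  /-- the prime element -/
  ϖ : 𝒪[K]
  irreducible : Irreducible ϖ
  /-- the degree of the residue field over its prime field -/
  c : ℕ
  c_pos : 0 < c
  /-- lifts of a basis of the residue field -/
  ε : Fin c → 𝒪[K]
  ε_zero : ε ⟨0, c_pos⟩ = 1
  linearIndependent :
    letI := charP_residueField K p
    letI := ZMod.algebra 𝓀[K] p
    LinearIndependent (ZMod p) fun i => IsLocalRing.residue 𝒪[K] (ε i)
  span_eq_top :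
    letI := charP_residueField K p
    letI := ZMod.algebra 𝓀[K] p
    Submodule.span (ZMod p) (Set.range fun i => IsLocalRing.residue 𝒪[K] (ε i)) = ⊤

/-- The number `q` of elements of the residue field. -/
def residueCard : ℕ := Nat.card 𝓀[K]

end LocalField

variable {K : Type*} [Field K] [ValuativeRel K] [TopologicalSpace K]
  [IsNonarchimedeanLocalField K] {p : ℕ} [Fact p.Prime] [CharP K p]

namespace Choices

/-- The prime element as an element of `K`. -/
def prime (C : Choices K p) : K := (C.ϖ : K)

theorem prime_ne_zero (C : Choices K p) : C.prime ≠ 0 := by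
  intro h
  exact C.irreducible.ne_zero (Subtype.ext h)

/-- `(a₀ + a₁ ε₁ + ⋯ + a_{c-1} ε_{c-1}) ϖ⁻¹`, where `a₀, …, a_{c-1}` are the first `c` digits of `b`
in base `p`. -/
def uDigit (C : Choices K p) (b : ℕ) : K :=
  (∑ i : Fin C.c, ((b / p ^ (i : ℕ) % p : ℕ) : K) * (C.ε i : K)) * C.prime⁻¹

/-- `u(n) = u(b₀) + u(b₁) ϖ⁻¹ + ⋯ + u(bₛ) ϖ⁻ˢ`, where `n = b₀ + b₁ q + ⋯ + bₛ qˢ` in base `q`; the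
digits `bᵢ` with `i > n` vanish. -/
def u (C : Choices K p) (n : ℕ) : K :=
  ∑ i ∈ Finset.range (n + 1),
    C.uDigit (n / residueCard K ^ i % residueCard K) * (C.prime ^ i)⁻¹

end Choices

/-! ### Translations and dilations on `L²(K)` -/

variable [MeasurableSpace K] [BorelSpace K] (μ : Measure K) [μ.IsAddHaarMeasure]

theorem memLp_translate (y : K) (f : Lp ℂ 2 μ) : MemLp (fun x => f (x - y)) 2 μ :=
  (Lp.memLp f).comp_measurePreserving (measurePreserving_sub_right μ y)

theorem memLp_dilate {a : K} (ha : a ≠ 0) (f : Lp ℂ 2 μ) : MemLp (fun x => f (a * x)) 2 μ := by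
  have := secondCountable K
  let e : K ≃ₜ+ K :=
    { toFun := fun x => a * x
      invFun := fun x => a⁻¹ * x
      left_inv := fun x => inv_mul_cancel_left₀ ha x
      right_inv := fun x => mul_inv_cancel_left₀ ha x
      map_add' := fun x y => mul_add a x y
      continuous_toFun := continuous_const_mul a
      continuous_invFun := continuous_const_mul a⁻¹ }
  have he : Measurable (fun x : K => a * x) := (continuous_const_mul a).measurable
  have : (Measure.map (fun x : K => a * x) μ).IsAddHaarMeasure :=
    ContinuousAddEquiv.isAddHaarMeasure_map μ e
  have h := Measure.isAddLeftInvariant_eq_smul (Measure.map (fun x : K => a * x) μ) μ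
  refine MemLp.comp_of_map ?_ he.aemeasurable
  rw [h]
  exact (Lp.memLp f).smul_measure ENNReal.coe_ne_top

/-- The translation operator `(τ_y f)(x) = f(x - y)`. -/
def translation (y : K) (f : Lp ℂ 2 μ) : Lp ℂ 2 μ :=
  (memLp_translate μ y f).toLp fun x => f (x - y)

/-- The dilation operator `(δ_j f)(x) = q^{j/2} f(ϖ^{-j} x)`. -/
def dilation (C : Choices K p) (j : ℤ) (f : Lp ℂ 2 μ) : Lp ℂ 2 μ :=
  (((residueCard K : ℝ) ^ ((j : ℝ) / 2) : ℝ) : ℂ) •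
    (memLp_dilate μ (zpow_ne_zero (-j) C.prime_ne_zero) f).toLp fun x => f (C.prime ^ (-j) * x)

/-- The affine system `ψ^l_{j,k} = δ_j τ_{u(k)} ψ^l`, as a family indexed by `(l, j, k)`. -/
def affineSystem (C : Choices K p) {L : ℕ} (Ψ : Fin L → Lp ℂ 2 μ) :
    Fin L × ℤ × ℕ → Lp ℂ 2 μ :=
  fun (l, j, k) => dilation μ C j (translation μ (C.u k) (Ψ l))

/-- The quasi-affine system, as a family indexed by `(l, j, k)`: its members are `δ_j τ_{u(k)} ψ^l`
for `j ≥ 0`, and `q^{j/2} τ_{u(k)} δ_j ψ^l` for `j < 0`. -/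
def quasiAffineSystem (C : Choices K p) {L : ℕ} (Ψ : Fin L → Lp ℂ 2 μ) :
    Fin L × ℤ × ℕ → Lp ℂ 2 μ :=
  fun (l, j, k) =>
    if 0 ≤ j then dilation μ C j (translation μ (C.u k) (Ψ l))
    else (((residueCard K : ℝ) ^ ((j : ℝ) / 2) : ℝ) : ℂ) •
      translation μ (C.u k) (dilation μ C j (Ψ l))

end LocalFieldFrames

end

noncomputable section

namespace LocalFieldFrames

/-! ### Arithmetic of the translation set: digits, group structure, separation modulo `𝒪[K]`. -/

section Arithmetic

variable {K : Type*} [Field K] [ValuativeRel K] [TopologicalSpace K]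
  [IsNonarchimedeanLocalField K] {p : ℕ} [Fact p.Prime] [CharP K p]

/-! In characteristic `p` digits add without carrying, so Λ = {u(k)} is a subgroup of `K`. Distinct
points of Λ differ by a non-integral element, ϖ⁻¹Λ ⊆ Λ, and the u(a) with a < q^N represent Λ/ϖ⁻ᴺΛ.

Split each functional ∑ |⟨f, η⟩|² by the scale j (`level`). The affine part at scale j is invariant
under translation by ϖʲΛ, and the dilations, which are unitary, shift its scale. For j ≥ -N the
quasi-affine part at scale j is the average, over a < q^N, of the affine part at the translates of f
by -u(a) (`average_level_affineSystem`); for j ≥ 0 the two parts agree.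

Upper bounds only involve finitely many scales at a time. Averaging carries them from the affine to
the quasi-affine system; dilating until all chosen scales are nonnegative carries them back.

For lower bounds the remaining scales must be shown negligible. Given a Bessel bound it is enough to
treat f carried by a ball (`HasUpperBound.hasLowerBound_of_dense`). From quasi-affine to affine, f
is dilated towards 0: the nonnegative scales are dominated by the dilation invariant affine sum, and
the negative ones tend to 0 by Cauchy–Schwarz and dominated convergence
(`tendsto_tsum_level_quasiAffineSystem`). From affine to quasi-affine, the affine lower bound is
averaged over q^(R+M) translates. The scales below -(R+M) contribute at most ‖f‖² q⁻ᴹ (B + M ∑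
‖ψˡ‖²), since the representatives fall into M shells of constant valuation, on each of which the
relevant cells are disjoint (`pairwise_disjoint_affineCell`). This tends to 0 with M.

The two systems thus have the same upper bounds, and in the Bessel case the same lower bounds. The
optimal ones exist because the sets of bounds are closed. -/

theorem mem_integers_iff {K : Type*} [Field K] [ValuativeRel K] (x : K) :
    x ∈ 𝒪[K] ↔ valuation K x ≤ 1 := Iff.rfl

theorem residue_eq_zero_iff_valuation_lt_one (x : 𝒪[K]) :
    IsLocalRing.residue 𝒪[K] x = 0 ↔ valuation K (x : K) < 1 := by
  rw [IsLocalRing.residue_eq_zero_iff]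
  exact Valuation.Integer.not_isUnit_iff_valuation_lt_one

namespace Choices

variable (C : Choices K p)

theorem valuation_prime_lt_one : valuation K C.prime < 1 :=
  (residue_eq_zero_iff_valuation_lt_one C.ϖ).1 ((IsLocalRing.residue_eq_zero_iff _).2
    C.irreducible.not_isUnit)

theorem valuation_prime_pos : 0 < valuation K C.prime :=
  (Valuation.pos_iff _).2 C.prime_ne_zero

theorem valuation_le_of_lt_one {x : K} (hx : valuation K x < 1) :
    valuation K x ≤ valuation K C.prime := by
  have h : (⟨x, hx.le⟩ : 𝒪[K]) ∈ IsLocalRing.maximalIdeal 𝒪[K] :=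
    (IsLocalRing.residue_eq_zero_iff _).1 ((residue_eq_zero_iff_valuation_lt_one _).2 hx)
  rw [C.irreducible.maximalIdeal_eq, Ideal.mem_span_singleton] at h
  obtain ⟨y, hy⟩ := h
  have h2 : x = C.prime * y := congrArg Subtype.val hy
  rw [h2, map_mul]
  exact mul_le_of_le_one_right' y.2

/-- The integral element `a₀ + a₁ ε₁ + ⋯` with digits `aᵢ` those of `b` in base `p`. -/
def digit (b : ℕ) : 𝒪[K] := ∑ i : Fin C.c, ((b / p ^ (i : ℕ) % p : ℕ) : 𝒪[K]) * C.ε i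

theorem uDigit_eq (b : ℕ) : C.uDigit b = (C.digit b : K) * C.prime⁻¹ := by
  simp [uDigit, digit]

/-- The digit vectors are coordinates with respect to the basis formed by the residues of the `ε i`.
-/
theorem residue_sum_bijective :
    Function.Bijective fun a : Fin C.c → Fin p =>
      IsLocalRing.residue 𝒪[K] (∑ i, ((a i : ℕ) : 𝒪[K]) * C.ε i) := by
  let := charP_residueField K p
  let := ZMod.algebra 𝓀[K] p
  have hp : NeZero p := ⟨(Fact.out : p.Prime).ne_zero⟩
  let b : Module.Basis (Fin C.c) (ZMod p) 𝓀[K] :=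
    Module.Basis.mk C.linearIndependent C.span_eq_top.ge
  have hb : ∀ i, b i = IsLocalRing.residue 𝒪[K] (C.ε i) := fun i =>
    Module.Basis.mk_apply C.linearIndependent C.span_eq_top.ge i
  have h : (fun a : Fin C.c → Fin p =>
      IsLocalRing.residue 𝒪[K] (∑ i, ((a i : ℕ) : 𝒪[K]) * C.ε i)) =
      b.equivFun.symm ∘ fun (a : Fin C.c → Fin p) i => ((a i : ℕ) : ZMod p) := by
    funext a
    simp only [Function.comp, Module.Basis.equivFun_symm_apply, map_sum, map_mul, map_natCast, hb,
      Algebra.smul_def]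
  rw [h]
  refine b.equivFun.symm.bijective.comp ⟨fun a a' haa => ?_, fun z => ?_⟩
  · funext i
    have := congrFun haa i
    simp only [ZMod.natCast_eq_natCast_iff'] at this
    rw [Nat.mod_eq_of_lt (a i).2, Nat.mod_eq_of_lt (a' i).2] at this
    exact Fin.ext this
  · exact ⟨fun i => ⟨(z i).val, ZMod.val_lt _⟩, funext fun i => by simp⟩

theorem digit_finFunctionFinEquiv (a : Fin C.c → Fin p) :
    C.digit (finFunctionFinEquiv a : ℕ) = ∑ i, ((a i : ℕ) : 𝒪[K]) * C.ε i := by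
  unfold digit
  refine Finset.sum_congr rfl fun i _ => ?_
  have := congrFun (finFunctionFinEquiv.symm_apply_apply a) i
  rw [← this]
  simp [finFunctionFinEquiv]

theorem residue_digit_bijective :
    Function.Bijective fun b : Fin (p ^ C.c) => IsLocalRing.residue 𝒪[K] (C.digit b) := by
  have h : (fun b : Fin (p ^ C.c) => IsLocalRing.residue 𝒪[K] (C.digit b)) =
      (fun a : Fin C.c → Fin p =>
        IsLocalRing.residue 𝒪[K] (∑ i, ((a i : ℕ) : 𝒪[K]) * C.ε i)) ∘ finFunctionFinEquiv.symm := by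
    funext b
    simp only [Function.comp, ← digit_finFunctionFinEquiv, Equiv.apply_symm_apply]
  rw [h]
  exact C.residue_sum_bijective.comp finFunctionFinEquiv.symm.bijective

theorem residueCard_eq (C : Choices K p) : residueCard K = p ^ C.c := by
  rw [residueCard, ← Nat.card_congr (Equiv.ofBijective _ C.residue_digit_bijective), Nat.card_fin]

theorem one_lt_residueCard (C : Choices K p) : 1 < residueCard K := by
  rw [C.residueCard_eq]
  exact Nat.one_lt_pow C.c_pos.ne' (Fact.out : p.Prime).one_lt

theorem residueCard_pos (C : Choices K p) : 0 < residueCard K := zero_lt_one.trans C.one_lt_residueCard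

theorem cast_residueCard_ne_zero (C : Choices K p) : (residueCard K : ℝ≥0∞) ≠ 0 := by
  exact_mod_cast C.residueCard_pos.ne'

theorem digit_zero : C.digit 0 = 0 := by simp [digit]

/-- Digits are added modulo `p` place by place; nothing is carried because `p = 0` in `K`. -/
theorem exists_digit_add (a b : ℕ) :
    ∃ c < residueCard K, C.digit a + C.digit b = C.digit c := by
  have hp : 0 < p := (Fact.out : p.Prime).pos
  let f : Fin C.c → Fin p := fun i =>
    ⟨(a / p ^ (i : ℕ) % p + b / p ^ (i : ℕ) % p) % p, Nat.mod_lt _ hp⟩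
  refine ⟨finFunctionFinEquiv f, by rw [C.residueCard_eq]; exact (finFunctionFinEquiv f).2, ?_⟩
  rw [digit_finFunctionFinEquiv, digit, digit, ← Finset.sum_add_distrib]
  refine Finset.sum_congr rfl fun i _ => ?_
  rw [← add_mul, ← Nat.cast_add]
  congr 1
  apply Subtype.ext
  simp only [f, SubringClass.coe_natCast]
  exact (CharP.cast_eq_mod K p _)

theorem uDigit_zero : C.uDigit 0 = 0 := by simp [uDigit_eq, digit_zero]

theorem u_eq_sum_range {n M : ℕ} (h : n < M) : C.u n = ∑ i ∈ Finset.range M,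
    C.uDigit (n / residueCard K ^ i % residueCard K) * (C.prime ^ i)⁻¹ := by
  unfold u
  refine Finset.sum_subset (Finset.range_mono h) fun i _ hi => ?_
  have h1 : n < residueCard K ^ i :=
    (by simpa using hi : n + 1 ≤ i).trans (Nat.lt_pow_self C.one_lt_residueCard).le
  rw [Nat.div_eq_of_lt h1, Nat.zero_mod, uDigit_zero, zero_mul]

theorem u_zero : C.u 0 = 0 := by simp [u, uDigit_zero]

theorem u_eq (n : ℕ) :
    C.u n = C.uDigit (n % residueCard K) + C.prime⁻¹ * C.u (n / residueCard K) := by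
  rw [C.u_eq_sum_range (Nat.lt_succ_self n),
    C.u_eq_sum_range (M := n + 1) (Nat.lt_succ_of_le (Nat.div_le_self _ _)),
    Finset.sum_range_succ', Finset.sum_range_succ]
  have h1 : n / residueCard K / residueCard K ^ n % residueCard K = 0 := by
    rw [Nat.div_eq_of_lt, Nat.zero_mod]
    exact (Nat.div_le_self _ _).trans_lt (Nat.lt_pow_self C.one_lt_residueCard)
  rw [h1, uDigit_zero, zero_mul, add_zero, pow_zero, Nat.div_one, pow_zero, inv_one, mul_one,
    add_comm, Finset.mul_sum]
  congr 1
  refine Finset.sum_congr rfl fun i _ => ?_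
  rw [pow_succ', Nat.div_div_eq_div_mul, pow_succ' C.prime, mul_inv]
  ring

theorem u_add_mul {a : ℕ} (ha : a < residueCard K) (b : ℕ) :
    C.u (a + residueCard K * b) = C.uDigit a + C.prime⁻¹ * C.u b := by
  rw [u_eq, Nat.add_mul_mod_self_left, Nat.mod_eq_of_lt ha,
    Nat.add_mul_div_left _ _ C.residueCard_pos, Nat.div_eq_of_lt ha, zero_add]

theorem u_of_lt {a : ℕ} (ha : a < residueCard K) : C.u a = C.uDigit a := by
  simpa [u_zero] using C.u_add_mul ha 0

/-- Cutting the base-q expansion after N digits. This is the coset decomposition of Λ modulo ϖ⁻ᴺΛ,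
with representatives u(a) for a < q^N. -/
theorem u_add_pow_mul (N : ℕ) {a : ℕ} (ha : a < residueCard K ^ N) (b : ℕ) :
    C.u (a + residueCard K ^ N * b) = C.u a + (C.prime ^ N)⁻¹ * C.u b := by
  induction N generalizing a with
  | zero =>
    obtain rfl : a = 0 := by simpa using ha
    simp [u_zero]
  | succ N ih =>
    have hq := C.residueCard_pos
    have e : a + residueCard K ^ (N + 1) * b = a % residueCard K +
        residueCard K * (a / residueCard K + residueCard K ^ N * b) := by
      conv_lhs => rw [← Nat.mod_add_div a (residueCard K)]
      ring
    rw [e, C.u_add_mul (Nat.mod_lt _ hq), ih, C.u_eq a, pow_succ', mul_inv]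
    · ring
    · rw [Nat.div_lt_iff_lt_mul hq, ← pow_succ]; exact ha

theorem exists_u_add (a b : ℕ) : ∃ c, C.u a + C.u b = C.u c := by
  induction a using Nat.strong_induction_on generalizing b with
  | _ a ih =>
    rcases Nat.eq_zero_or_pos a with rfl | ha
    · exact ⟨b, by rw [u_zero, zero_add]⟩
    obtain ⟨c, hc⟩ := ih (a / residueCard K) (Nat.div_lt_self ha C.one_lt_residueCard)
      (b / residueCard K)
    obtain ⟨d, hd, hd'⟩ := C.exists_digit_add (a % residueCard K) (b % residueCard K)
    refine ⟨d + residueCard K * c, ?_⟩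
    rw [C.u_add_mul hd, ← hc, C.u_eq a, C.u_eq b, C.uDigit_eq d, ← hd', uDigit_eq, uDigit_eq]
    push_cast
    ring

theorem exists_u_neg (a : ℕ) : ∃ c, -C.u a = C.u c := by
  have h : ∀ n : ℕ, ∃ c, (n : K) * C.u a = C.u c := by
    intro n
    induction n with
    | zero => exact ⟨0, by simp [u_zero]⟩
    | succ n ih =>
      obtain ⟨c, hc⟩ := ih
      obtain ⟨d, hd⟩ := C.exists_u_add c a
      exact ⟨d, by rw [← hd, ← hc]; push_cast; ring⟩
  obtain ⟨c, hc⟩ := h (p - 1)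
  refine ⟨c, ?_⟩
  -- In characteristic p, negation is multiplication by p - 1, which is repeated addition.
  rw [← hc, Nat.cast_sub (Fact.out : p.Prime).one_le, CharP.cast_eq_zero]
  simp

theorem valuation_digit_eq_one {b : ℕ} (hb : b < residueCard K) (hb0 : b ≠ 0) :
    valuation K (C.digit b : K) = 1 := by
  refine le_antisymm (C.digit b).2 (not_lt.1 fun h => hb0 ?_)
  rw [← residue_eq_zero_iff_valuation_lt_one] at h
  rw [C.residueCard_eq] at hb
  have h0 : 0 < p ^ C.c := by have := (Fact.out : p.Prime).pos; positivity
  have := C.residue_digit_bijective.1 (a₁ := ⟨b, hb⟩) (a₂ := ⟨0, h0⟩) (by simp [h, digit_zero])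
  simpa using this

theorem valuation_uDigit_le (b : ℕ) : valuation K (C.uDigit b) ≤ (valuation K C.prime)⁻¹ := by
  rw [uDigit_eq, map_mul, map_inv₀]
  exact mul_le_of_le_one_left' (C.digit b).2

/-- The valuation of `u b` is that of its leading digit. -/
theorem exists_valuation_u {M b : ℕ} (hb : b < residueCard K ^ M) (hb0 : b ≠ 0) :
    ∃ t ∈ Finset.Icc 1 M, valuation K (C.u b) = (valuation K C.prime ^ t)⁻¹ := by
  induction M generalizing b with
  | zero => exact absurd (by simpa using hb) hb0
  | succ M ih =>
    rcases lt_or_ge b (residueCard K) with h | h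
    · refine ⟨1, by simp, ?_⟩
      rw [C.u_of_lt h, uDigit_eq, map_mul, C.valuation_digit_eq_one h hb0, map_inv₀]
      simp
    · have h1 : b / residueCard K < residueCard K ^ M := by
        rw [Nat.div_lt_iff_lt_mul C.residueCard_pos, ← pow_succ]; exact hb
      obtain ⟨t, ht, hv⟩ := ih h1 (Nat.div_pos h C.residueCard_pos).ne'
      rw [Finset.mem_Icc] at ht
      have hpos := C.valuation_prime_pos
      have h2 : valuation K (C.prime⁻¹ * C.u (b / residueCard K)) =
          (valuation K C.prime ^ (t + 1))⁻¹ := by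
        rw [map_mul, hv, map_inv₀, pow_succ', mul_inv]
      refine ⟨t + 1, by simp; omega, ?_⟩
      rw [C.u_eq b, Valuation.map_add_eq_of_lt_right, h2]
      rw [h2]
      -- The lowest digit has valuation at most |ϖ|⁻¹, strictly below |ϖ|^(-(t+1)) since t ≥ 1, so
      -- the higher digits decide.
      refine (C.valuation_uDigit_le _).trans_lt ?_
      refine inv_strictAnti₀ (pow_pos hpos _) ?_
      exact pow_lt_self_of_lt_one₀ hpos C.valuation_prime_lt_one (by omega)

theorem valuation_u_le {M b : ℕ} (hb : b < residueCard K ^ M) :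
    valuation K (C.u b) ≤ (valuation K C.prime ^ M)⁻¹ := by
  rcases eq_or_ne b 0 with rfl | h0
  · simp [u_zero]
  obtain ⟨t, ht, hv⟩ := C.exists_valuation_u hb h0
  rw [hv]
  rw [Finset.mem_Icc] at ht
  have := C.valuation_prime_pos
  exact inv_anti₀ (pow_pos this _)
    (pow_le_pow_right_of_le_one' C.valuation_prime_lt_one.le ht.2)

theorem eq_zero_of_u_mem {b : ℕ} (h : C.u b ∈ 𝒪[K]) : b = 0 := by
  by_contra h0
  obtain ⟨t, ht, hv⟩ := C.exists_valuation_u (Nat.lt_pow_self C.one_lt_residueCard) h0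
  rw [mem_integers_iff, hv] at h
  have := C.valuation_prime_pos
  rw [Finset.mem_Icc] at ht
  exact absurd h (not_le.2 ((one_lt_inv₀ (pow_pos this _)).2
    (pow_lt_one₀ this.le C.valuation_prime_lt_one (by omega))))

/-- Λ meets `𝒪[K]` only in 0, so the two points coincide; the digits are then recovered one at a
time. Every disjointness statement below rests on this separation. -/
theorem u_inj_of_sub_mem {a b : ℕ} (h : C.u a - C.u b ∈ 𝒪[K]) : a = b := by
  have key : ∀ a b : ℕ, C.u a - C.u b ∈ 𝒪[K] → C.u a = C.u b := by
    intro a b h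
    obtain ⟨b', hb'⟩ := C.exists_u_neg b
    obtain ⟨c, hc⟩ := C.exists_u_add a b'
    rw [← hb', ← sub_eq_add_neg] at hc
    rw [hc] at h
    rw [C.eq_zero_of_u_mem h, u_zero] at hc
    exact sub_eq_zero.1 hc
  have h' := key a b h
  clear h
  induction a using Nat.strong_induction_on generalizing b with
  | _ a ih =>
    have hq := C.residueCard_pos
    have h1 := h'
    rw [C.u_eq a, C.u_eq b, uDigit_eq, uDigit_eq] at h1
    -- The higher parts differ by an integral element, hence are equal; the lowest digits are then
    -- equal as well.
    have h2 : C.u (a / residueCard K) - C.u (b / residueCard K) =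
        (C.digit (b % residueCard K) - C.digit (a % residueCard K) : 𝒪[K]) := by
      have := C.prime_ne_zero
      push_cast
      field_simp at h1
      linear_combination h1
    have h3 : C.u (a / residueCard K) = C.u (b / residueCard K) :=
      key _ _ (by rw [h2]; exact Subtype.property _)
    rw [h3, sub_self] at h2
    have h4 : C.digit (b % residueCard K) = C.digit (a % residueCard K) := by
      rw [← sub_eq_zero]; exact Subtype.ext h2.symm
    have ha := Nat.mod_lt a hq
    have hb := Nat.mod_lt b hq
    have h5 : b % residueCard K = a % residueCard K := by
      rw [C.residueCard_eq] at ha hb ⊢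
      have := C.residue_digit_bijective.1 (a₁ := ⟨_, hb⟩) (a₂ := ⟨_, ha⟩)
        (by rw [C.residueCard_eq] at h4; simp only [h4])
      simpa using this
    rcases Nat.eq_zero_or_pos a with rfl | hapos
    · exact (C.eq_zero_of_u_mem (b := b) (by rw [← h', u_zero]; exact zero_mem _)).symm
    · have h6 := ih _ (Nat.div_lt_self hapos C.one_lt_residueCard) h3
      rw [← Nat.mod_add_div a (residueCard K), ← Nat.mod_add_div b (residueCard K), h5, h6]

theorem u_injective : Function.Injective C.u := fun a b h =>
  C.u_inj_of_sub_mem (by rw [h, sub_self]; exact zero_mem _)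

/-- The translation set is a subgroup. -/
def lattice : AddSubgroup K where
  carrier := Set.range C.u
  add_mem' := by
    rintro _ _ ⟨a, rfl⟩ ⟨b, rfl⟩
    obtain ⟨c, hc⟩ := C.exists_u_add a b
    exact ⟨c, hc.symm⟩
  zero_mem' := ⟨0, C.u_zero⟩
  neg_mem' := by
    rintro _ ⟨a, rfl⟩
    obtain ⟨c, hc⟩ := C.exists_u_neg a
    exact ⟨c, hc.symm⟩

/-- A sum over k is a sum over the group Λ, on which translation is a bijection. -/
theorem tsum_u_add (F : K → ℝ≥0∞) (m : ℕ) : ∑' k, F (C.u k + C.u m) = ∑' k, F (C.u k) := by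
  let e : ℕ ≃ C.lattice := Equiv.ofInjective C.u C.u_injective
  let y : C.lattice := e m
  have h1 : ∀ G : K → ℝ≥0∞, ∑' k, G (C.u k) = ∑' z : C.lattice, G z := fun G =>
    e.tsum_eq (fun z : C.lattice => G z)
  rw [h1, h1 fun x => F (x + C.u m)]
  exact (Equiv.addRight y).tsum_eq (fun z : C.lattice => F z)

theorem tsum_eq_sum_range_tsum (C : Choices K p) (F : ℕ → ℝ≥0∞) (N : ℕ) :
    ∑' k, F k = ∑ a ∈ Finset.range (residueCard K ^ N), ∑' b, F (a + residueCard K ^ N * b) := by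
  have hq := C.residueCard_pos
  have : NeZero (residueCard K ^ N) := ⟨(by positivity)⟩
  rw [← (Nat.divModEquiv (residueCard K ^ N)).symm.tsum_eq, ENNReal.tsum_prod', ENNReal.tsum_comm,
    tsum_fintype, Finset.sum_range]
  refine Finset.sum_congr rfl fun a _ => tsum_congr fun b => ?_
  congr 1
  simp [Nat.divModEquiv]
  ring

theorem sum_range_pow_add (F : ℕ → ℝ≥0∞) (n m : ℕ) :
    ∑ k ∈ Finset.range (residueCard K ^ (n + m)), F k =
      ∑ a ∈ Finset.range (residueCard K ^ n), ∑ b ∈ Finset.range (residueCard K ^ m),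
        F (a + residueCard K ^ n * b) := by
  simp only [pow_add, Finset.sum_range]
  rw [Finset.sum_comm, mul_comm, ← Fintype.sum_prod_type', ← finProdFinEquiv.sum_comp]
  rfl

theorem exists_sub_prime_mul_u_mem {x : K} (hx : x ∈ 𝒪[K]) :
    ∃ a < residueCard K, valuation K (x - C.prime * C.u a) ≤ valuation K C.prime := by
  obtain ⟨b, hb⟩ := C.residue_digit_bijective.2 (IsLocalRing.residue 𝒪[K] ⟨x, hx⟩)
  have hb2 : (b : ℕ) < residueCard K := by rw [C.residueCard_eq]; exact b.2
  refine ⟨b, hb2, C.valuation_le_of_lt_one ?_⟩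
  have h : IsLocalRing.residue 𝒪[K] (⟨x, hx⟩ - C.digit b) = 0 := by
    rw [map_sub, sub_eq_zero]; exact hb.symm
  rw [residue_eq_zero_iff_valuation_lt_one] at h
  rw [C.u_of_lt hb2, uDigit_eq]
  convert h using 2
  have := C.prime_ne_zero
  push_cast
  field_simp

end Choices

end Arithmetic

/-! ### The mass of an L² function on a set, and local Cauchy–Schwarz. -/

section Mass

variable {α : Type*} [MeasurableSpace α] {μ : Measure α}

theorem enorm_eq_of_inner_self_eq {H : Type*} [NormedAddCommGroup H] [InnerProductSpace ℂ H]
    {f g : H} (h : inner ℂ f f = inner ℂ g g) :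
    ‖f‖ₑ = ‖g‖ₑ := by
  have h2 : ‖f‖ = ‖g‖ := by
    rw [norm_eq_sqrt_re_inner (𝕜 := ℂ) f, norm_eq_sqrt_re_inner (𝕜 := ℂ) g, h]
  rw [← ofReal_norm, ← ofReal_norm, h2]

/-- The mass `∫_E |f|²`. -/
def mass (f : Lp ℂ 2 μ) (E : Set α) : ℝ≥0∞ := ∫⁻ x in E, ‖f x‖ₑ ^ 2 ∂μ

theorem mass_univ (f : Lp ℂ 2 μ) : mass f Set.univ = ‖f‖ₑ ^ 2 := by
  rw [mass, Measure.restrict_univ, Lp.enorm_def,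
    eLpNorm_eq_lintegral_rpow_enorm_toReal (by norm_num) (by norm_num)]
  simp only [ENNReal.toReal_ofNat, ENNReal.rpow_ofNat]
  rw [← ENNReal.rpow_natCast, ← ENNReal.rpow_mul]
  norm_num

theorem mass_le (f : Lp ℂ 2 μ) (E : Set α) : mass f E ≤ ‖f‖ₑ ^ 2 := by
  rw [← mass_univ]
  exact lintegral_mono_set (Set.subset_univ _)

theorem tsum_mass_le {ι : Type*} [Countable ι] (f : Lp ℂ 2 μ) {E : ι → Set α}
    (hE : ∀ i, MeasurableSet (E i)) (hd : Pairwise (Function.onFun Disjoint E)) :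
    ∑' i, mass f (E i) ≤ ‖f‖ₑ ^ 2 := by
  unfold mass
  rw [← lintegral_iUnion hE hd]
  exact mass_le f _

/-- Cauchy–Schwarz for a function which is carried by `E`. -/
theorem enorm_inner_sq_le {f : Lp ℂ 2 μ} (g : Lp ℂ 2 μ) {E : Set α} (hE : MeasurableSet E)
    (hf : ∀ᵐ x ∂μ, x ∉ E → f x = 0) : ‖inner ℂ f g‖ₑ ^ 2 ≤ ‖f‖ₑ ^ 2 * mass g E := by
  have h1 : ‖inner ℂ f g‖ₑ ≤ ∫⁻ x, ‖f x‖ₑ * (E.indicator (fun x => ‖g x‖ₑ) x) ∂μ := by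
    rw [L2.inner_def]
    refine (enorm_integral_le_lintegral_enorm _).trans (lintegral_mono_ae ?_)
    filter_upwards [hf] with x hx
    by_cases hxE : x ∈ E
    · rw [Set.indicator_of_mem hxE, RCLike.inner_apply, enorm_mul, mul_comm]
      simp
    · simp [hx hxE]
  have h2 := ENNReal.lintegral_mul_le_Lp_mul_Lq μ (Real.HolderConjugate.two_two)
    (Lp.aestronglyMeasurable f).enorm ((Lp.aestronglyMeasurable g).enorm.indicator hE)
  have h3 := pow_le_pow_left' (h1.trans h2) 2
  rw [mul_pow] at h3
  have h4 : ∀ a : ℝ≥0∞, (a ^ (1 / 2 : ℝ)) ^ 2 = a := fun a => by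
    rw [← ENNReal.rpow_natCast, ← ENNReal.rpow_mul]; norm_num
  rw [h4, h4] at h3
  refine h3.trans (le_of_eq ?_)
  rw [← mass_univ, mass, mass, Measure.restrict_univ, ← lintegral_indicator hE]
  congr 1
  · simp
  · refine lintegral_congr fun x => ?_
    by_cases hxE : x ∈ E <;> simp [hxE]

end Mass

theorem enorm_sq_rpow_half {K : Type*} [Field K] [ValuativeRel K] [TopologicalSpace K]
    [IsNonarchimedeanLocalField K] {p : ℕ} [Fact p.Prime] [CharP K p] (C : Choices K p) (j : ℤ) :
    ‖(((residueCard K : ℝ) ^ ((j : ℝ) / 2) : ℝ) : ℂ)‖ₑ ^ 2 = (residueCard K : ℝ≥0∞) ^ j := by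
  have hR : (0 : ℝ) < residueCard K := by exact_mod_cast C.residueCard_pos
  rw [← ofReal_norm, Complex.norm_real, Real.norm_of_nonneg (by positivity),
    ← ENNReal.ofReal_pow (by positivity), ← Real.rpow_natCast, ← Real.rpow_mul hR.le,
    ← ENNReal.ofReal_natCast, ← ENNReal.rpow_intCast, ENNReal.ofReal_rpow_of_pos hR]
  congr 2
  push_cast; ring

/-! ### Translations and dilations as unitary operators. -/

section Operators

variable {K : Type*} [Field K] [ValuativeRel K] [TopologicalSpace K]
  [IsNonarchimedeanLocalField K] {p : ℕ} [Fact p.Prime] [CharP K p]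
  [MeasurableSpace K] [BorelSpace K]

theorem measurableSet_integers : MeasurableSet (𝒪[K] : Set K) := by
  have h : (𝒪[K] : Set K) ∈ nhds 0 :=
    Filter.mem_of_superset ((IsValuativeTopology.hasBasis_nhds_zero' K).mem_of_mem one_ne_zero)
      fun x (hx : valuation K x < 1) => hx.le
  exact ((𝒪[K] : Subring K).toAddSubgroup.isOpen_of_mem_nhds (g := 0) h).measurableSet

theorem measurableEmbedding_mul_left {a : K} (ha : a ≠ 0) :
    MeasurableEmbedding fun x : K => a * x :=
  (Homeomorph.mulLeft₀ a ha).measurableEmbedding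

variable (μ : Measure K) [μ.IsAddHaarMeasure]

theorem exists_map_mul_left_eq_smul {a : K} (ha : a ≠ 0) :
    ∃ c : ℝ≥0, μ.map (fun x : K => a * x) = (c : ℝ≥0∞) • μ := by
  have := secondCountable K
  let e : K ≃ₜ+ K :=
    { toFun := fun x => a * x
      invFun := fun x => a⁻¹ * x
      left_inv := fun x => inv_mul_cancel_left₀ ha x
      right_inv := fun x => mul_inv_cancel_left₀ ha x
      map_add' := fun x y => mul_add a x y
      continuous_toFun := continuous_const_mul a
      continuous_invFun := continuous_const_mul a⁻¹ }
  have : (μ.map (fun x : K => a * x)).IsAddHaarMeasure :=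
    ContinuousAddEquiv.isAddHaarMeasure_map μ e
  exact ⟨_, Measure.isAddLeftInvariant_eq_smul (μ.map (fun x : K => a * x)) μ⟩

variable {μ}

/-- `𝒪[K]` is the disjoint union of the q translates of ϖ`𝒪[K]` by ϖu(a), a < q. -/
theorem residueCard_mul_measure_prime_mul (hμ : μ (𝒪[K] : Set K) = 1) (C : Choices K p) :
    (residueCard K : ℝ≥0∞) * μ {x | C.prime⁻¹ * x ∈ 𝒪[K]} = 1 := by
  have := secondCountable K
  have hpi := C.prime_ne_zero
  have hm : ∀ a : ℕ, MeasurableSet {x : K | C.prime⁻¹ * x - C.u a ∈ 𝒪[K]} := fun a =>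
    (by fun_prop : Measurable fun x : K => C.prime⁻¹ * x - C.u a) measurableSet_integers
  have h1 : (𝒪[K] : Set K) =
      ⋃ a ∈ Finset.range (residueCard K), {x : K | C.prime⁻¹ * x - C.u a ∈ 𝒪[K]} := by
    have hpos := C.valuation_prime_pos
    have key : ∀ (x : K) (a : ℕ), C.prime⁻¹ * x - C.u a ∈ 𝒪[K] ↔
        valuation K (x - C.prime * C.u a) ≤ valuation K C.prime := by
      intro x a
      have : C.prime⁻¹ * x - C.u a = C.prime⁻¹ * (x - C.prime * C.u a) := by field_simp
      rw [this, mem_integers_iff, map_mul, map_inv₀, inv_mul_le_iff₀ hpos, mul_one]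
    ext x
    simp only [Set.mem_iUnion, Finset.mem_range, Set.mem_ofPred_eq, key, exists_prop]
    refine ⟨fun hx => C.exists_sub_prime_mul_u_mem hx, ?_⟩
    rintro ⟨a, ha, hx⟩
    have h2 : C.prime * C.u a ∈ 𝒪[K] := by
      rw [C.u_of_lt ha, C.uDigit_eq, mul_comm, mul_assoc, inv_mul_cancel₀ hpi, mul_one]
      exact Subtype.property _
    have h3 : x - C.prime * C.u a ∈ 𝒪[K] := hx.trans C.valuation_prime_lt_one.le
    have h4 := add_mem h3 h2
    rwa [sub_add_cancel] at h4
  have h2 : ∀ a : ℕ, μ {x : K | C.prime⁻¹ * x - C.u a ∈ 𝒪[K]} =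
      μ {x | C.prime⁻¹ * x ∈ 𝒪[K]} := by
    intro a
    have h3 : MeasurableSet {x : K | C.prime⁻¹ * x ∈ 𝒪[K]} :=
      (measurable_const_mul _) measurableSet_integers
    rw [← (measurePreserving_sub_right μ (C.prime * C.u a)).measure_preimage h3.nullMeasurableSet]
    congr 1
    ext x
    simp only [Set.mem_preimage, Set.mem_ofPred_eq]
    congr! 1
    field_simp
  rw [h1, measure_biUnion_finset _ fun a _ => hm a] at hμ
  · simpa [h2] using hμ
  · intro a _ b _ hab
    refine Set.disjoint_left.2 fun x hx hx' => hab ?_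
    refine C.u_inj_of_sub_mem ?_
    have h := (𝒪[K]).sub_mem hx' hx
    simpa using h

/-- Uniqueness of Haar measure gives a constant; evaluation on ϖ`𝒪[K]`, whose preimage is `𝒪[K]`,
identifies it as q. -/
theorem map_prime_mul (hμ : μ (𝒪[K] : Set K) = 1) (C : Choices K p) :
    μ.map (fun x : K => C.prime * x) = (residueCard K : ℝ≥0∞) • μ := by
  obtain ⟨c, hc⟩ := exists_map_mul_left_eq_smul μ C.prime_ne_zero
  have h1 := residueCard_mul_measure_prime_mul hμ C
  have h2 := congrArg (fun ν : Measure K => ν {x | C.prime⁻¹ * x ∈ 𝒪[K]}) hc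
  simp only [Measure.smul_apply, smul_eq_mul] at h2
  rw [(measurableEmbedding_mul_left C.prime_ne_zero).map_apply] at h2
  have h3 : (fun x : K => C.prime * x) ⁻¹' {x | C.prime⁻¹ * x ∈ 𝒪[K]} = (𝒪[K] : Set K) := by
    ext x
    simp [C.prime_ne_zero]
  rw [h3, hμ, ← h1] at h2
  rw [hc]
  congr 1
  have h0 : μ {x | C.prime⁻¹ * x ∈ 𝒪[K]} ≠ 0 := by
    intro h; rw [h, mul_zero] at h1; exact zero_ne_one h1
  have ht : μ {x | C.prime⁻¹ * x ∈ 𝒪[K]} ≠ ∞ := by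
    intro h
    rw [h, ENNReal.mul_top (by exact_mod_cast C.residueCard_pos.ne')] at h1
    exact ENNReal.top_ne_one h1
  exact ((ENNReal.mul_left_inj h0 ht).1 h2).symm

theorem map_prime_zpow_mul (hμ : μ (𝒪[K] : Set K) = 1) (C : Choices K p) (j : ℤ) :
    μ.map (fun x : K => C.prime ^ j * x) = (residueCard K : ℝ≥0∞) ^ j • μ := by
  have := secondCountable K
  have hq := C.cast_residueCard_ne_zero
  have hq' : (residueCard K : ℝ≥0∞) ≠ ∞ := ENNReal.natCast_ne_top _
  have hm : ∀ a : K, Measurable fun x : K => a * x := fun a => by fun_prop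
  have hinv : μ.map (fun x : K => C.prime⁻¹ * x) = (residueCard K : ℝ≥0∞)⁻¹ • μ := by
    have h := congrArg (fun ν : Measure K => ν.map (fun x : K => C.prime⁻¹ * x))
      (map_prime_mul hμ C)
    simp only [Measure.map_smul] at h
    rw [Measure.map_map (hm _) (hm _)] at h
    have h2 : (fun x : K => C.prime⁻¹ * x) ∘ (fun x => C.prime * x) = id := by
      funext x; simp [C.prime_ne_zero]
    rw [h2, Measure.map_id] at h
    conv_rhs => rw [h]
    rw [smul_smul, ENNReal.inv_mul_cancel hq hq', one_smul]
  induction j with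
  | zero => simp
  | succ n ih =>
    have h2 : (fun x : K => C.prime ^ ((n : ℤ) + 1) * x) =
        (fun x => C.prime * x) ∘ (fun x => C.prime ^ (n : ℤ) * x) := by
      funext x; simp [zpow_add₀ C.prime_ne_zero]; ring
    rw [h2, ← Measure.map_map (hm _) (hm _), ih, Measure.map_smul, map_prime_mul hμ, smul_smul,
      ENNReal.zpow_add hq hq', zpow_one]
  | pred n ih =>
    have h2 : (fun x : K => C.prime ^ (-(n : ℤ) - 1) * x) =
        (fun x => C.prime⁻¹ * x) ∘ (fun x => C.prime ^ (-(n : ℤ)) * x) := by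
      funext x; simp [zpow_sub₀ C.prime_ne_zero]; ring
    rw [h2, ← Measure.map_map (hm _) (hm _), ih, Measure.map_smul, hinv, smul_smul,
      sub_eq_add_neg, ENNReal.zpow_add hq hq', zpow_neg_one]

theorem quasiMeasurePreserving_mul_left {a : K} (ha : a ≠ 0) :
    Measure.QuasiMeasurePreserving (fun x : K => a * x) μ μ := by
  refine ⟨(measurableEmbedding_mul_left ha).measurable, ?_⟩
  obtain ⟨c, hc⟩ := exists_map_mul_left_eq_smul μ ha
  rw [hc]
  exact Measure.smul_absolutelyContinuous

variable (μ)

theorem quasiMeasurePreserving_sub (y : K) :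
    Measure.QuasiMeasurePreserving (fun x : K => x - y) μ μ :=
  (measurePreserving_sub_right μ y).quasiMeasurePreserving

theorem coeFn_translation (y : K) (f : Lp ℂ 2 μ) :
    translation μ y f =ᵐ[μ] fun x => f (x - y) := MemLp.coeFn_toLp _

theorem coeFn_dilation (C : Choices K p) (j : ℤ) (f : Lp ℂ 2 μ) :
    dilation μ C j f =ᵐ[μ] fun x =>
      (((residueCard K : ℝ) ^ ((j : ℝ) / 2) : ℝ) : ℂ) * f (C.prime ^ (-j) * x) := by
  unfold dilation
  filter_upwards [Lp.coeFn_smul (((residueCard K : ℝ) ^ ((j : ℝ) / 2) : ℝ) : ℂ)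
    ((memLp_dilate μ (zpow_ne_zero (-j) C.prime_ne_zero) f).toLp fun x => f (C.prime ^ (-j) * x)),
    (memLp_dilate μ (zpow_ne_zero (-j) C.prime_ne_zero) f).coeFn_toLp] with x h1 h2
  rw [h1, Pi.smul_apply, h2, smul_eq_mul]

theorem translation_translation (y z : K) (f : Lp ℂ 2 μ) :
    translation μ y (translation μ z f) = translation μ (y + z) f := by
  apply Lp.ext
  filter_upwards [coeFn_translation μ y (translation μ z f), coeFn_translation μ (y + z) f,
    (quasiMeasurePreserving_sub μ y).ae (coeFn_translation μ z f)] with x h1 h2 h3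
  rw [h1, h2, h3, sub_sub]

theorem translation_zero (f : Lp ℂ 2 μ) : translation μ 0 f = f := by
  apply Lp.ext
  filter_upwards [coeFn_translation μ 0 f] with x h1
  rw [h1, sub_zero]

theorem dilation_dilation (C : Choices K p) (i j : ℤ) (f : Lp ℂ 2 μ) :
    dilation μ C i (dilation μ C j f) = dilation μ C (i + j) f := by
  apply Lp.ext
  filter_upwards [coeFn_dilation μ C i (dilation μ C j f), coeFn_dilation μ C (i + j) f,
    (quasiMeasurePreserving_mul_left (zpow_ne_zero (-i) C.prime_ne_zero)).ae
      (coeFn_dilation μ C j f)] with x h1 h2 h3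
  rw [h1, h2, h3, ← mul_assoc, ← mul_assoc, ← zpow_add₀ C.prime_ne_zero, ← Complex.ofReal_mul,
    ← Real.rpow_add (by exact_mod_cast C.residueCard_pos)]
  congr 3
  · push_cast; ring
  · congr 1; ring

theorem dilation_zero (C : Choices K p) (f : Lp ℂ 2 μ) : dilation μ C 0 f = f := by
  apply Lp.ext
  filter_upwards [coeFn_dilation μ C 0 f] with x h1
  rw [h1]
  simp

theorem dilation_translation (C : Choices K p) (j : ℤ) (y : K) (f : Lp ℂ 2 μ) :
    dilation μ C j (translation μ y f) = translation μ (C.prime ^ j * y) (dilation μ C j f) := by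
  apply Lp.ext
  filter_upwards [coeFn_dilation μ C j (translation μ y f),
    coeFn_translation μ (C.prime ^ j * y) (dilation μ C j f),
    (quasiMeasurePreserving_mul_left (zpow_ne_zero (-j) C.prime_ne_zero)).ae
      (coeFn_translation μ y f),
    (quasiMeasurePreserving_sub μ (C.prime ^ j * y)).ae (coeFn_dilation μ C j f)] with x h1 h2 h3 h4
  rw [h1, h2, h3, h4, mul_sub, ← mul_assoc, ← zpow_add₀ C.prime_ne_zero]
  simp

theorem inner_translation_translation (y : K) (f g : Lp ℂ 2 μ) :
    inner ℂ (translation μ y f) (translation μ y g) = inner ℂ f g := by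
  rw [L2.inner_def, L2.inner_def, ← integral_sub_right_eq_self (fun x => inner ℂ (f x) (g x)) y]
  refine integral_congr_ae ?_
  filter_upwards [coeFn_translation μ y f, coeFn_translation μ y g] with x h1 h2
  rw [h1, h2]

variable {μ}

theorem inner_dilation_dilation (hμ : μ (𝒪[K] : Set K) = 1) (C : Choices K p) (j : ℤ)
    (f g : Lp ℂ 2 μ) : inner ℂ (dilation μ C j f) (dilation μ C j g) = inner ℂ f g := by
  have hq : (0 : ℝ) < residueCard K := by exact_mod_cast C.residueCard_pos
  have h0 : ∫ x, inner ℂ (f (C.prime ^ (-j) * x)) (g (C.prime ^ (-j) * x)) ∂μ =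
      (((residueCard K : ℝ) ^ (-j) : ℝ) : ℂ) * ∫ x, inner ℂ (f x) (g x) ∂μ := by
    rw [← (measurableEmbedding_mul_left (zpow_ne_zero (-j) C.prime_ne_zero)).integral_map
      (fun x => inner ℂ (f x) (g x)), map_prime_zpow_mul hμ, integral_smul_measure]
    have : ((residueCard K : ℝ≥0∞) ^ (-j)).toReal = (residueCard K : ℝ) ^ (-j) := by
      rw [← ENNReal.rpow_intCast, ← ENNReal.toReal_rpow, Real.rpow_intCast, ENNReal.toReal_natCast]
    rw [this]
    simp
  rw [L2.inner_def, L2.inner_def]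
  have h1 : ∫ x, inner ℂ (dilation μ C j f x) (dilation μ C j g x) ∂μ =
      ∫ x, (((residueCard K : ℝ) ^ j : ℝ) : ℂ) *
        inner ℂ (f (C.prime ^ (-j) * x)) (g (C.prime ^ (-j) * x)) ∂μ := by
    refine integral_congr_ae ?_
    filter_upwards [coeFn_dilation μ C j f, coeFn_dilation μ C j g] with x h1 h2
    have h3 : (residueCard K : ℝ) ^ j =
        (residueCard K : ℝ) ^ ((j : ℝ) / 2) * (residueCard K : ℝ) ^ ((j : ℝ) / 2) := by
      rw [← Real.rpow_add hq, add_halves, Real.rpow_intCast]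
    rw [h1, h2, h3]
    simp only [RCLike.inner_apply, map_mul, Complex.conj_ofReal, Complex.ofReal_mul]
    ring
  rw [h1, integral_const_mul, h0, ← mul_assoc, ← Complex.ofReal_mul, ← zpow_add₀ hq.ne']
  simp

variable (μ) in
theorem enorm_translation (y : K) (f : Lp ℂ 2 μ) : ‖translation μ y f‖ₑ = ‖f‖ₑ :=
  enorm_eq_of_inner_self_eq (inner_translation_translation μ y f f)

theorem enorm_dilation (hμ : μ (𝒪[K] : Set K) = 1) (C : Choices K p) (j : ℤ) (f : Lp ℂ 2 μ) :
    ‖dilation μ C j f‖ₑ = ‖f‖ₑ :=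
  enorm_eq_of_inner_self_eq (inner_dilation_dilation hμ C j f f)

theorem inner_dilation_left (hμ : μ (𝒪[K] : Set K) = 1) (C : Choices K p) (j : ℤ)
    (f g : Lp ℂ 2 μ) : inner ℂ (dilation μ C j f) g = inner ℂ f (dilation μ C (-j) g) := by
  rw [← inner_dilation_dilation hμ C j f, dilation_dilation, add_neg_cancel, dilation_zero]

variable (μ) in
theorem inner_translation_neg_left (y : K) (f g : Lp ℂ 2 μ) :
    inner ℂ (translation μ (-y) f) g = inner ℂ f (translation μ y g) := by
  rw [← inner_translation_translation μ y (translation μ (-y) f), translation_translation,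
    add_neg_cancel, translation_zero]

variable (μ) in
theorem mass_translation (y : K) (f : Lp ℂ 2 μ) (E : Set K) :
    mass (translation μ y f) E = mass f {x | x + y ∈ E} := by
  unfold mass
  have h1 : ∫⁻ x in E, ‖translation μ y f x‖ₑ ^ 2 ∂μ = ∫⁻ x in E, ‖f (x - y)‖ₑ ^ 2 ∂μ :=
    lintegral_congr_ae (ae_restrict_of_ae (by
      filter_upwards [coeFn_translation μ y f] with x hx
      rw [hx]))
  rw [h1]
  have h2 := ((measurePreserving_add_right μ y).setLIntegral_comp_preimage_emb
    (Homeomorph.addRight y).measurableEmbedding (fun x => ‖f (x - y)‖ₑ ^ 2) E)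
  rw [← h2]
  simp only [add_sub_cancel_right]
  rfl

theorem mass_dilation (hμ : μ (𝒪[K] : Set K) = 1) (C : Choices K p) (j : ℤ) (f : Lp ℂ 2 μ)
    (E : Set K) :
    mass (dilation μ C j f) E = mass f {x | C.prime ^ j * x ∈ E} := by
  have hq := C.cast_residueCard_ne_zero
  have hq' : (residueCard K : ℝ≥0∞) ≠ ∞ := ENNReal.natCast_ne_top _
  have hm := measurableEmbedding_mul_left (zpow_ne_zero j C.prime_ne_zero)
  unfold mass
  have h1 : ∫⁻ x in E, ‖dilation μ C j f x‖ₑ ^ 2 ∂μ =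
      ∫⁻ x in E, (residueCard K : ℝ≥0∞) ^ j * ‖f (C.prime ^ (-j) * x)‖ₑ ^ 2 ∂μ :=
    lintegral_congr_ae (ae_restrict_of_ae (by
      filter_upwards [coeFn_dilation μ C j f] with x hx
      rw [hx, enorm_mul, mul_pow, enorm_sq_rpow_half C]))
  have h4 : ∫⁻ x in E, ‖f (C.prime ^ (-j) * x)‖ₑ ^ 2 ∂((residueCard K : ℝ≥0∞) ^ j • μ) =
      ∫⁻ x in {x | C.prime ^ j * x ∈ E}, ‖f x‖ₑ ^ 2 ∂μ := by
    rw [← map_prime_zpow_mul hμ C j, hm.restrict_map, hm.lintegral_map]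
    simp only [← mul_assoc, ← zpow_add₀ C.prime_ne_zero]
    simp
    rfl
  rw [h1, ← h4, Measure.restrict_smul, lintegral_smul_measure, lintegral_const_mul']
  · rfl
  · exact ENNReal.zpow_ne_top hq hq' j

end Operators

/-! ### Existence of optimal bounds, and lower bounds on dense sets. -/

section FrameBounds

variable {ι H : Type*} [NormedAddCommGroup H] [InnerProductSpace ℂ H]

/-- Each f imposes a closed condition on B. Closedness makes the infimum of the bounds itself a
bound. -/
theorem isClosed_setOf_hasUpperBound (η : ι → H) : IsClosed {B : ℝ≥0 | HasUpperBound η B} := by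
  simp only [HasUpperBound, Set.ofPred_forall]
  refine isClosed_iInter fun f => isClosed_le continuous_const ?_
  exact (ENNReal.continuous_mul_const (by simp)).comp ENNReal.continuous_coe

theorem isClosed_setOf_hasLowerBound (η : ι → H) : IsClosed {A : ℝ≥0 | HasLowerBound η A} := by
  simp only [HasLowerBound, Set.ofPred_forall]
  refine isClosed_iInter fun f => isClosed_le ?_ continuous_const
  exact (ENNReal.continuous_mul_const (by simp)).comp ENNReal.continuous_coe

theorem IsBesselFamily.exists_isOptimalUpperBound {η : ι → H} (h : IsBesselFamily η) :
    ∃ B, IsOptimalUpperBound η B := by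
  obtain ⟨B, -, hB⟩ := h
  exact ⟨_, (isClosed_setOf_hasUpperBound η).csInf_mem ⟨B, hB⟩ (OrderBot.bddBelow _),
    fun _ hx => csInf_le (OrderBot.bddBelow _) hx⟩

theorem IsBesselFamily.exists_isOptimalLowerBound [Nontrivial H] {η : ι → H}
    (h : IsBesselFamily η) : ∃ A, IsOptimalLowerBound η A := by
  obtain ⟨B, -, hB⟩ := h
  obtain ⟨f, hf⟩ := exists_ne (0 : H)
  -- A nonzero vector is needed here: in the zero space every number is a lower bound.
  have hb : BddAbove {A : ℝ≥0 | HasLowerBound η A} := by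
    refine ⟨B, fun A hA => ?_⟩
    have h1 := (hA f).trans (hB f)
    rw [ENNReal.mul_le_mul_iff_left (by simpa using hf) (by simp)] at h1
    exact_mod_cast h1
  exact ⟨_, (isClosed_setOf_hasLowerBound η).csSup_mem ⟨0, fun f => by simp⟩ hb,
    fun _ hx => le_csSup hb hx⟩

theorem HasUpperBound.isBesselFamily {η : ι → H} {B : ℝ≥0} (h : HasUpperBound η B) :
    IsBesselFamily η := by
  refine ⟨B + 1, by positivity, fun f => (h f).trans ?_⟩
  gcongr
  simp

theorem IsFrame.isBesselFamily {η : ι → H} (h : IsFrame η) : IsBesselFamily η := by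
  obtain ⟨A, B, hA, hAB, -, hB⟩ := h
  exact ⟨B, hA.trans_le hAB, hB⟩

/-- Writing the sum as a squared ℓ² norm, for counting measure on the discrete σ-algebra, makes
Minkowski's inequality available. -/
theorem frameSum_eq_eLpNorm_sq (η : ι → H) (f : H) :
    frameSum η f =
      eLpNorm (fun i => inner ℂ f (η i)) 2 (@Measure.count ι ⊤) ^ 2 := by
  let := (⊤ : MeasurableSpace ι)
  rw [eLpNorm_eq_lintegral_rpow_enorm_toReal (by norm_num) (by norm_num),
    lintegral_count' measurable_from_top]
  simp only [ENNReal.toReal_ofNat, ENNReal.rpow_ofNat]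
  rw [← ENNReal.rpow_natCast, ← ENNReal.rpow_mul]
  norm_num [frameSum]

theorem eLpNorm_inner_le (η : ι → H) (f g : H) :
    eLpNorm (fun i => inner ℂ f (η i)) 2 (@Measure.count ι ⊤) ≤
      eLpNorm (fun i => inner ℂ g (η i)) 2 (@Measure.count ι ⊤) +
        eLpNorm (fun i => inner ℂ (f - g) (η i)) 2 (@Measure.count ι ⊤) := by
  let := (⊤ : MeasurableSpace ι)
  have hm : ∀ h : H, AEStronglyMeasurable (fun i => inner ℂ h (η i)) (Measure.count : Measure ι) :=
    fun h => (measurable_from_top).aestronglyMeasurable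
  refine le_trans (le_of_eq ?_) (eLpNorm_add_le (hm g) (hm (f - g)) (by norm_num))
  congr 1
  funext i
  simp

/-- For a Bessel family, a lower bound on a dense set is a lower bound. -/
theorem HasUpperBound.hasLowerBound_of_dense {η : ι → H} {A B : ℝ≥0} (hB : HasUpperBound η B)
    {S : Set H} (hS : Dense S) (hA : ∀ f ∈ S, (A : ℝ≥0∞) * ‖f‖ₑ ^ 2 ≤ frameSum η f) :
    HasLowerBound η A := by
  let s : H → ℝ≥0∞ := fun f => eLpNorm (fun i => inner ℂ f (η i)) 2 (@Measure.count ι ⊤)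
  have hs : ∀ f, frameSum η f = s f ^ 2 := frameSum_eq_eLpNorm_sq η
  have hsq : ∀ (D : ℝ≥0) (f : H),
      (D : ℝ≥0∞) * ‖f‖ₑ ^ 2 = ((NNReal.sqrt D : ℝ≥0) * ‖f‖ₑ) ^ 2 := by
    intro D f
    rw [mul_pow, ← ENNReal.coe_pow, NNReal.sq_sqrt]
  have hlow : ∀ g ∈ S, (NNReal.sqrt A : ℝ≥0) * ‖g‖ₑ ≤ s g := by
    intro g hg
    have := hA g hg
    rw [hs, hsq] at this
    exact (ENNReal.pow_right_strictMono two_ne_zero).le_iff_le.1 this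
  have hup : ∀ g, s g ≤ (NNReal.sqrt B : ℝ≥0) * ‖g‖ₑ := by
    intro g
    have := hB g
    rw [hs, hsq] at this
    exact (ENNReal.pow_right_strictMono two_ne_zero).le_iff_le.1 this
  intro f
  rw [hs, hsq]
  -- With f fixed, this closed condition on g holds on S by Minkowski's inequality and the Bessel
  -- bound, hence at g = f, where the last term vanishes.
  have hcl : IsClosed {g : H | (NNReal.sqrt A : ℝ≥0∞) * ‖g‖ₑ ≤
      s f + (NNReal.sqrt B : ℝ≥0) * ‖g - f‖ₑ} := by
    refine isClosed_le ?_ ?_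
    · exact (ENNReal.continuous_const_mul (by simp)).comp continuous_enorm
    · exact continuous_const.add ((ENNReal.continuous_const_mul (by simp)).comp
        (continuous_enorm.comp (continuous_id.sub continuous_const)))
  have h := hcl.closure_subset_iff.2 (fun g hg =>
    (hlow g hg).trans ((eLpNorm_inner_le η g f).trans (add_le_add le_rfl (hup _)))) (hS f)
  have h' : (NNReal.sqrt A : ℝ≥0∞) * ‖f‖ₑ ≤ s f := by simpa using h
  gcongr

end FrameBounds

/-! ### Decomposition by scales, averaging, and equality of upper bounds. -/

section Levels

variable {K : Type*} [Field K] [ValuativeRel K] [TopologicalSpace K]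
  [IsNonarchimedeanLocalField K] {p : ℕ} [Fact p.Prime] [CharP K p]
  [MeasurableSpace K] [BorelSpace K] {μ : Measure K} [μ.IsAddHaarMeasure]

/-- The part of `frameSum` which belongs to the scale `j`. -/
def level {H : Type*} [NormedAddCommGroup H] [InnerProductSpace ℂ H] {L : ℕ}
    (η : Fin L × ℤ × ℕ → H) (j : ℤ) (f : H) : ℝ≥0∞ :=
  ∑ l, ∑' k, ‖inner ℂ f (η (l, j, k))‖ₑ ^ 2

theorem frameSum_eq_tsum_level {H : Type*} [NormedAddCommGroup H] [InnerProductSpace ℂ H] {L : ℕ}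
    (η : Fin L × ℤ × ℕ → H) (f : H) : frameSum η f = ∑' j, level η j f := by
  rw [frameSum, ENNReal.tsum_prod', tsum_fintype]
  simp only [ENNReal.tsum_prod', level]
  rw [Summable.tsum_finsetSum fun _ _ => ENNReal.summable]

variable {L : ℕ} (C : Choices K p) (Ψ : Fin L → Lp ℂ 2 μ)

theorem level_affineSystem_dilation (hμ : μ (𝒪[K] : Set K) = 1) (j m : ℤ) (f : Lp ℂ 2 μ) :
    level (affineSystem μ C Ψ) j (dilation μ C m f) = level (affineSystem μ C Ψ) (j - m) f := by
  unfold level affineSystem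
  simp only [inner_dilation_left hμ, dilation_dilation, neg_add_eq_sub]

theorem level_quasiAffineSystem_of_nonneg {j : ℤ} (hj : 0 ≤ j) (f : Lp ℂ 2 μ) :
    level (quasiAffineSystem μ C Ψ) j f = level (affineSystem μ C Ψ) j f := by
  unfold level quasiAffineSystem affineSystem
  simp only [if_pos hj]

/-- A translation by ϖʲu(m) passes through δ_j as a translation by u(m), which only permutes Λ. -/
theorem level_affineSystem_translation (j : ℤ) (m : ℕ) (f : Lp ℂ 2 μ) :
    level (affineSystem μ C Ψ) j (translation μ (-(C.prime ^ j * C.u m)) f) =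
      level (affineSystem μ C Ψ) j f := by
  unfold level affineSystem
  refine Finset.sum_congr rfl fun l _ => ?_
  simp only [inner_translation_neg_left, ← dilation_translation, translation_translation]
  simp only [add_comm (C.u m)]
  exact C.tsum_u_add (fun y => ‖inner ℂ f (dilation μ C j (translation μ y (Ψ l)))‖ₑ ^ 2) m

theorem level_affineSystem_translation_of_nonneg (n m : ℕ) (f : Lp ℂ 2 μ) :
    level (affineSystem μ C Ψ) n (translation μ (-C.u m) f) = level (affineSystem μ C Ψ) n f := by
  have h := C.u_add_pow_mul n (a := 0) (by have := C.residueCard_pos; positivity) m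
  rw [C.u_zero, zero_add, zero_add] at h
  -- For n ≥ 0 this is the inclusion Λ ⊆ ϖⁿΛ.
  have h2 : C.u m = C.prime ^ (n : ℤ) * C.u (residueCard K ^ n * m) := by
    rw [h, zpow_natCast, mul_inv_cancel_left₀ (pow_ne_zero _ C.prime_ne_zero)]
  rw [h2, level_affineSystem_translation]

/-- With k = a + qⁿb, the part ϖ⁻ⁿu(b) of u(k) commutes past δ₋ₙ and becomes the affine index b,
while u(a) moves onto f. The factor q⁻ⁿ is the square of the normalisation q^(j/2) at j = -n. -/
theorem level_quasiAffineSystem_neg {n : ℕ} (hn : n ≠ 0) (f : Lp ℂ 2 μ) :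
    level (quasiAffineSystem μ C Ψ) (-n) f = ((residueCard K : ℝ≥0∞) ^ n)⁻¹ *
      ∑ a ∈ Finset.range (residueCard K ^ n),
        level (affineSystem μ C Ψ) (-n) (translation μ (-C.u a) f) := by
  have hn' : ¬ (0 : ℤ) ≤ -n := by omega
  unfold level quasiAffineSystem affineSystem
  rw [Finset.sum_comm, Finset.mul_sum]
  refine Finset.sum_congr rfl fun l _ => ?_
  simp only [if_neg hn', inner_smul_right, enorm_mul, mul_pow, enorm_sq_rpow_half C]
  rw [ENNReal.tsum_mul_left, ENNReal.zpow_neg, zpow_natCast, C.tsum_eq_sum_range_tsum _ n]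
  congr 1
  refine Finset.sum_congr rfl fun a ha => tsum_congr fun b => ?_
  rw [C.u_add_pow_mul n (Finset.mem_range.1 ha), inner_translation_neg_left, dilation_translation,
    translation_translation, zpow_neg, zpow_natCast]

/-- The quasi-affine functional at the scale `j ≥ -N` is the average of the affine one over the
translations by the representatives `u a`, `a < q ^ N`, of the lattice modulo `ϖ⁻ᴺ` times the lattice. -/
theorem average_level_affineSystem {N : ℕ} {j : ℤ} (hj : -(N : ℤ) ≤ j) (f : Lp ℂ 2 μ) :
    ((residueCard K : ℝ≥0∞) ^ N)⁻¹ * ∑ a ∈ Finset.range (residueCard K ^ N),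
        level (affineSystem μ C Ψ) j (translation μ (-C.u a) f) =
      level (quasiAffineSystem μ C Ψ) j f := by
  have hq := C.cast_residueCard_ne_zero
  have hq' : (residueCard K : ℝ≥0∞) ≠ ∞ := ENNReal.natCast_ne_top _
  rcases le_or_gt 0 j with h0 | h0
  · lift j to ℕ using h0
    simp only [level_affineSystem_translation_of_nonneg, Finset.sum_const, Finset.card_range,
      nsmul_eq_mul, level_quasiAffineSystem_of_nonneg C Ψ (Int.natCast_nonneg j)]
    rw [Nat.cast_pow, ENNReal.inv_mul_cancel_left' (by simp [hq]) (by simp [hq'])]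
  · obtain ⟨n, hn, rfl⟩ : ∃ n : ℕ, n ≠ 0 ∧ j = -n := ⟨j.natAbs, by omega, by omega⟩
    -- Scale -n is invariant under ϖ⁻ⁿΛ, so the average over q^(n+m) representatives collapses to
    -- the one over qⁿ.
    obtain ⟨m, rfl⟩ : ∃ m, N = n + m := ⟨N - n, by omega⟩
    rw [Choices.sum_range_pow_add, level_quasiAffineSystem_neg C Ψ hn]
    have h : ∀ a ∈ Finset.range (residueCard K ^ n), ∀ b,
        level (affineSystem μ C Ψ) (-n) (translation μ (-C.u (a + residueCard K ^ n * b)) f) =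
          level (affineSystem μ C Ψ) (-n) (translation μ (-C.u a) f) := by
      intro a ha b
      rw [C.u_add_pow_mul n (Finset.mem_range.1 ha), neg_add_rev, ← translation_translation,
        ← zpow_natCast, ← zpow_neg, level_affineSystem_translation]
    rw [Finset.sum_congr rfl fun a ha => Finset.sum_congr rfl fun b _ => h a ha b]
    simp only [Finset.sum_const, Finset.card_range, nsmul_eq_mul, ← Finset.mul_sum, Nat.cast_pow]
    rw [pow_add, ENNReal.mul_inv (by simp [hq]) (by simp [hq']), mul_assoc,
      ENNReal.inv_mul_cancel_left' (by simp [hq]) (by simp [hq'])]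

variable {C Ψ}

theorem hasUpperBound_quasiAffineSystem {B : ℝ≥0} (h : HasUpperBound (affineSystem μ C Ψ) B) :
    HasUpperBound (quasiAffineSystem μ C Ψ) B := by
  have hq := C.cast_residueCard_ne_zero
  have hq' : (residueCard K : ℝ≥0∞) ≠ ∞ := ENNReal.natCast_ne_top _
  intro f
  rw [frameSum_eq_tsum_level, ENNReal.tsum_eq_iSup_sum]
  refine iSup_le fun s => ?_
  obtain ⟨N, hN⟩ : ∃ N : ℕ, ∀ j ∈ s, -(N : ℤ) ≤ j := by
    refine ⟨s.sup Int.natAbs, fun j hj => ?_⟩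
    have := Finset.le_sup (f := Int.natAbs) hj
    omega
  rw [Finset.sum_congr rfl fun j hj => (average_level_affineSystem C Ψ (hN j hj) f).symm,
    ← Finset.mul_sum, Finset.sum_comm]
  calc _ ≤ ((residueCard K : ℝ≥0∞) ^ N)⁻¹ *
        ∑ a ∈ Finset.range (residueCard K ^ N), (B : ℝ≥0∞) * ‖f‖ₑ ^ 2 := by
        gcongr with a _
        refine (ENNReal.sum_le_tsum s).trans ?_
        rw [← frameSum_eq_tsum_level, ← enorm_translation μ (-C.u a) f]
        exact h _
    _ = _ := by
        rw [Finset.sum_const, Finset.card_range, nsmul_eq_mul, Nat.cast_pow,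
          ENNReal.inv_mul_cancel_left' (by simp [hq]) (by simp [hq'])]

/-- A dilation moves any finite set of scales to nonnegative ones, where both systems agree, without
changing ‖f‖. -/
theorem hasUpperBound_affineSystem (hμ : μ (𝒪[K] : Set K) = 1) {B : ℝ≥0}
    (h : HasUpperBound (quasiAffineSystem μ C Ψ) B) : HasUpperBound (affineSystem μ C Ψ) B := by
  intro f
  rw [frameSum_eq_tsum_level, ENNReal.tsum_eq_iSup_sum]
  refine iSup_le fun s => ?_
  obtain ⟨N, hN⟩ : ∃ N : ℕ, ∀ j ∈ s, 0 ≤ j + (N : ℤ) := by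
    refine ⟨s.sup Int.natAbs, fun j hj => ?_⟩
    have := Finset.le_sup (f := Int.natAbs) hj
    omega
  have h1 : ∀ j ∈ s, level (affineSystem μ C Ψ) j f =
      level (quasiAffineSystem μ C Ψ) (j + N) (dilation μ C N f) := by
    intro j hj
    rw [level_quasiAffineSystem_of_nonneg C Ψ (hN j hj), level_affineSystem_dilation C Ψ hμ,
      add_sub_cancel_right]
  rw [Finset.sum_congr rfl h1, ← enorm_dilation hμ C N f]
  refine le_trans ?_ (h _)
  rw [frameSum_eq_tsum_level, ← (Equiv.addRight (N : ℤ)).tsum_eq]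
  exact ENNReal.sum_le_tsum (f := fun j => level (quasiAffineSystem μ C Ψ) (j + N) _) s

theorem frameSum_affineSystem_dilation (hμ : μ (𝒪[K] : Set K) = 1) (m : ℤ) (f : Lp ℂ 2 μ) :
    frameSum (affineSystem μ C Ψ) (dilation μ C m f) = frameSum (affineSystem μ C Ψ) f := by
  simp only [frameSum_eq_tsum_level, level_affineSystem_dilation C Ψ hμ]
  exact (Equiv.subRight m).tsum_eq fun j => level (affineSystem μ C Ψ) j f

end Levels

/-! ### Sums over the integers and limits of sums. -/

open Filter Topology

theorem tsum_int_eq_tsum_add_tsum (F : ℤ → ℝ≥0∞) (N : ℕ) :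
    ∑' j, F j = ∑' n : ℕ, F (n - N) + ∑' n : ℕ, F (-(N + 1 + n : ℕ)) := by
  rw [← (Equiv.subRight (N : ℤ)).tsum_eq F,
    (HasSum.of_nat_of_neg_add_one (f := fun j => F (Equiv.subRight (N : ℤ) j))
      ENNReal.summable.hasSum ENNReal.summable.hasSum).tsum_eq]
  congr 1
  refine tsum_congr fun n => ?_
  congr 1
  simp only [Equiv.subRight_apply]
  push_cast
  ring

theorem tsum_nat_le_tsum_int (F : ℤ → ℝ≥0∞) (N : ℕ) : ∑' n : ℕ, F (n - N) ≤ ∑' j, F j := by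
  rw [tsum_int_eq_tsum_add_tsum F N]
  exact le_self_add

theorem tsum_neg_le_tsum_int (F : ℤ → ℝ≥0∞) (N : ℕ) :
    ∑' n : ℕ, F (-(N + 1 + n : ℕ)) ≤ ∑' j, F j := by
  rw [tsum_int_eq_tsum_add_tsum F N]
  exact le_add_self

/-- Dominated convergence for sums in `[0, ∞]` tending to zero. -/
theorem tendsto_tsum_zero_of_dominated {ι : Type*} {F : ℕ → ι → ℝ≥0∞} (G : ι → ℝ≥0∞)
    (hF : ∀ n i, F n i ≤ G i) (hG : ∑' i, G i ≠ ∞)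
    (h : ∀ i, Tendsto (fun n => F n i) atTop (𝓝 0)) :
    Tendsto (fun n => ∑' i, F n i) atTop (𝓝 0) := by
  let := (⊤ : MeasurableSpace ι)
  have h1 := tendsto_lintegral_of_dominated_convergence (μ := (Measure.count : Measure ι))
    (F := F) (f := fun _ => 0) G (fun n => measurable_from_top)
    (fun n => Eventually.of_forall (hF n)) (by rwa [lintegral_count' measurable_from_top])
    (Eventually.of_forall h)
  simpa only [lintegral_count' measurable_from_top, tsum_zero] using h1

theorem tendsto_inv_pow_mul_add_mul {q : ℕ} (hq : 1 < q) {a b : ℝ≥0∞} (ha : a ≠ ∞) (hb : b ≠ ∞) :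
    Tendsto (fun M : ℕ => ((q : ℝ≥0∞) ^ M)⁻¹ * (a + M * b)) atTop (𝓝 0) := by
  lift a to ℝ≥0 using ha
  lift b to ℝ≥0 using hb
  have hq1 : (1 : ℝ) < q := by exact_mod_cast hq
  have h1 : Tendsto (fun M : ℕ => (M : ℝ) ^ 0 / (q : ℝ) ^ M * a + (M : ℝ) ^ 1 / (q : ℝ) ^ M * b)
      atTop (𝓝 (0 * a + 0 * b)) :=
    ((tendsto_pow_const_div_const_pow_of_one_lt 0 hq1).mul_const _).add
      ((tendsto_pow_const_div_const_pow_of_one_lt 1 hq1).mul_const _)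
  have h2 := ENNReal.tendsto_ofReal h1
  simp only [zero_mul, add_zero, ENNReal.ofReal_zero] at h2
  refine h2.congr fun M => ?_
  have hq0 : (0 : ℝ) < (q : ℝ) ^ M := by positivity
  have h3 : (M : ℝ) ^ 0 / (q : ℝ) ^ M * a + (M : ℝ) ^ 1 / (q : ℝ) ^ M * b =
      ((q : ℝ) ^ M)⁻¹ * (a + M * b) := by
    field_simp
  rw [h3, ENNReal.ofReal_mul (by positivity), ENNReal.ofReal_inv_of_pos hq0,
    ENNReal.ofReal_pow (by positivity), ENNReal.ofReal_add (by positivity) (by positivity),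
    ENNReal.ofReal_mul (by positivity)]
  simp

/-! ### Balls exhausting `K`, and density of the functions carried by them. -/

section Ball

variable {K : Type*} [Field K] [ValuativeRel K] [TopologicalSpace K]
  [IsNonarchimedeanLocalField K] {p : ℕ} [Fact p.Prime] [CharP K p]

/-- The ball `{x | ϖ ^ R x ∈ 𝒪}`. -/
def Choices.ball (C : Choices K p) (R : ℕ) : Set K := {x | C.prime ^ R * x ∈ 𝒪[K]}

theorem Choices.monotone_ball (C : Choices K p) : Monotone C.ball := by
  refine monotone_nat_of_le_succ fun R x hx => ?_
  have h : C.prime ^ (R + 1) * x = C.prime * (C.prime ^ R * x) := by ring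
  change C.prime ^ (R + 1) * x ∈ 𝒪[K]
  rw [h]
  exact mul_mem C.ϖ.2 hx

theorem Choices.iUnion_ball (C : Choices K p) : ⋃ R, C.ball R = Set.univ := by
  refine Set.eq_univ_of_forall fun x => Set.mem_iUnion.2 ?_
  rcases eq_or_ne x 0 with rfl | hx
  · exact ⟨0, by simp [ball]⟩
  have hx' : valuation K x ≠ 0 := (Valuation.ne_zero_iff _).2 hx
  have : MulArchimedean (ValueGroupWithZero K) :=
    ValuativeRel.isRankLeOne_iff_mulArchimedean.1 inferInstance
  obtain ⟨R, hR⟩ := exists_pow_lt₀ C.valuation_prime_lt_one (Units.mk0 _ hx')⁻¹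
  refine ⟨R, ?_⟩
  change valuation K (C.prime ^ R * x) ≤ 1
  rw [map_mul, map_pow]
  rw [Units.val_inv_eq_inv_val, Units.val_mk0,
    lt_inv_comm₀ (pow_pos C.valuation_prime_pos _) (zero_lt_iff.2 hx')] at hR
  rw [mul_comm, ← le_mul_inv_iff₀ (pow_pos C.valuation_prime_pos _), one_mul]
  exact hR.le

theorem Choices.mem_ball_iff (C : Choices K p) (R : ℕ) (x : K) :
    x ∈ C.ball R ↔ valuation K x ≤ (valuation K C.prime ^ R)⁻¹ := by
  change valuation K (C.prime ^ R * x) ≤ 1 ↔ _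
  rw [map_mul, map_pow, mul_comm, ← le_mul_inv_iff₀ (pow_pos C.valuation_prime_pos _), one_mul]

end Ball

section Carried

/-- `f` vanishes almost everywhere outside `E`. -/
def IsCarriedBy {α : Type*} [MeasurableSpace α] {μ : Measure α} (f : Lp ℂ 2 μ) (E : Set α) : Prop :=
  ∀ᵐ x ∂μ, x ∉ E → f x = 0

theorem mass_compl_eq_enorm_sub_sq {α : Type*} [MeasurableSpace α] {μ : Measure α} (f : Lp ℂ 2 μ)
    {E : Set α} (hE : MeasurableSet E) :
    ‖((Lp.memLp f).indicator hE).toLp (E.indicator f) - f‖ₑ ^ 2 = mass f Eᶜ := by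
  rw [← mass_univ, mass, mass, Measure.restrict_univ, ← lintegral_indicator hE.compl]
  refine lintegral_congr_ae ?_
  filter_upwards [Lp.coeFn_sub (((Lp.memLp f).indicator hE).toLp (E.indicator f)) f,
    ((Lp.memLp f).indicator hE).coeFn_toLp] with x h1 h2
  rw [h1, Pi.sub_apply, h2]
  by_cases hx : x ∈ E <;> simp [hx]

variable {K : Type*} [Field K] [ValuativeRel K] [TopologicalSpace K]
  [IsNonarchimedeanLocalField K] {p : ℕ} [Fact p.Prime] [CharP K p]
  [MeasurableSpace K] [BorelSpace K] {μ : Measure K} [μ.IsAddHaarMeasure]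

theorem IsCarriedBy.translation {f : Lp ℂ 2 μ} {E : Set K} (h : IsCarriedBy f E) (y : K) :
    IsCarriedBy (translation μ y f) {x | x - y ∈ E} := by
  filter_upwards [coeFn_translation μ y f, (quasiMeasurePreserving_sub μ y).ae h] with x h1 h2 h3
  rw [h1, h2 h3]

theorem IsCarriedBy.dilation (C : Choices K p) {f : Lp ℂ 2 μ} {E : Set K} (h : IsCarriedBy f E)
    (j : ℤ) : IsCarriedBy (dilation μ C j f) {x | C.prime ^ (-j) * x ∈ E} := by
  filter_upwards [coeFn_dilation μ C j f,
    (quasiMeasurePreserving_mul_left (zpow_ne_zero (-j) C.prime_ne_zero)).ae h] with x h1 h2 h3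
  rw [h1, h2 h3, mul_zero]

theorem Choices.measurableSet_ball (C : Choices K p) (R : ℕ) : MeasurableSet (C.ball R) :=
  have := secondCountable K
  (measurable_const_mul (C.prime ^ R)) measurableSet_integers

omit [μ.IsAddHaarMeasure] in
-- Continuity from above of the finite measure with density |f|², along complements of balls that
-- exhaust `K`.
theorem tendsto_mass_compl_ball (C : Choices K p) (f : Lp ℂ 2 μ) :
    Tendsto (fun R => mass f (C.ball R)ᶜ) atTop (𝓝 0) := by
  let ν := μ.withDensity fun x => ‖f x‖ₑ ^ 2
  have hν : ∀ E, MeasurableSet E → ν E = mass f E := fun E hE => withDensity_apply _ hE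
  have h := tendsto_measure_iInter_atTop (μ := ν) (s := fun R => (C.ball R)ᶜ)
    (fun R => (C.measurableSet_ball R).compl.nullMeasurableSet)
    (fun _ _ h => Set.compl_subset_compl.2 (C.monotone_ball h))
    ⟨0, by
      rw [hν _ (C.measurableSet_ball 0).compl]
      exact ne_top_of_le_ne_top (by simp) (mass_le f _)⟩
  rw [← Set.compl_iUnion, C.iUnion_ball, Set.compl_univ, measure_empty] at h
  exact h.congr fun R => hν _ (C.measurableSet_ball R).compl

theorem dense_setOf_isCarriedBy_ball (μ : Measure K) [μ.IsAddHaarMeasure] (C : Choices K p) :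
    Dense {f : Lp ℂ 2 μ | ∃ R, IsCarriedBy f (C.ball R)} := by
  intro f
  let g : ℕ → Lp ℂ 2 μ := fun R =>
    ((Lp.memLp f).indicator (C.measurableSet_ball R)).toLp ((C.ball R).indicator f)
  have h1 : Tendsto g atTop (𝓝 f) := by
    rw [tendsto_iff_edist_tendsto_0]
    have h2 := ((ENNReal.continuous_rpow_const (y := (1 / 2 : ℝ))).tendsto 0).comp
      (tendsto_mass_compl_ball C f)
    rw [ENNReal.zero_rpow_of_pos (by norm_num)] at h2
    refine h2.congr fun R => ?_
    rw [edist_eq_enorm_sub, Function.comp,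
      ← mass_compl_eq_enorm_sub_sq f (C.measurableSet_ball R), ← ENNReal.rpow_natCast,
      ← ENNReal.rpow_mul]
    norm_num [g]
  refine mem_closure_of_tendsto h1 (Eventually.of_forall fun R => ⟨R, ?_⟩)
  filter_upwards [((Lp.memLp f).indicator (C.measurableSet_ball R)).coeFn_toLp] with x hx hx'
  rw [hx, Set.indicator_of_notMem hx']

theorem IsCarriedBy.translation_ball {C : Choices K p} {f : Lp ℂ 2 μ} {R : ℕ}
    (h : IsCarriedBy f (C.ball R)) {y : K} (hy : y ∈ C.ball R) :
    IsCarriedBy (LocalFieldFrames.translation μ (-y) f) (C.ball R) := by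
  filter_upwards [h.translation (-y)] with x hx hx'
  refine hx fun h' => hx' ?_
  change C.prime ^ R * (x - -y) ∈ 𝒪[K] at h'
  change C.prime ^ R * y ∈ 𝒪[K] at hy
  change C.prime ^ R * x ∈ 𝒪[K]
  have := sub_mem h' hy
  rw [← mul_sub] at this
  simpa using this

end Carried

/-! ### Equality of lower bounds. -/

section LowerBounds

variable {K : Type*} [Field K] [ValuativeRel K] [TopologicalSpace K]
  [IsNonarchimedeanLocalField K] {p : ℕ} [Fact p.Prime] [CharP K p]
  [MeasurableSpace K] [BorelSpace K] {μ : Measure K} [μ.IsAddHaarMeasure]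
  {L : ℕ} {C : Choices K p} {Ψ : Fin L → Lp ℂ 2 μ}

theorem mass_dilation_translation (hμ : μ (𝒪[K] : Set K) = 1) (j : ℤ) (y : K) (f : Lp ℂ 2 μ)
    (E : Set K) : mass (dilation μ C j (translation μ y f)) E =
      mass f {x | C.prime ^ j * (x + y) ∈ E} := by
  rw [mass_dilation hμ, mass_translation]
  rfl

theorem mass_translation_dilation (hμ : μ (𝒪[K] : Set K) = 1) (j : ℤ) (y : K) (f : Lp ℂ 2 μ)
    (E : Set K) : mass (translation μ y (dilation μ C j f)) E =
      mass f {x | C.prime ^ j * x + y ∈ E} := by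
  rw [mass_translation, mass_dilation hμ]
  rfl

/-! ### The large scales of the quasi-affine functional -/

variable (C) in
/-- The set of `x` with `ϖ⁻ⁿ x + u k ∈ ϖᴹ 𝒪`. -/
def nearLattice (M n k : ℕ) : Set K :=
  {x | (C.prime ^ M)⁻¹ * ((C.prime ^ n)⁻¹ * x + C.u k) ∈ 𝒪[K]}

theorem measurableSet_nearLattice (M n k : ℕ) : MeasurableSet (nearLattice C M n k) :=
  have := secondCountable K
  (by fun_prop : Measurable fun x : K => (C.prime ^ M)⁻¹ * ((C.prime ^ n)⁻¹ * x + C.u k))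
    measurableSet_integers

omit [MeasurableSpace K] [BorelSpace K] in
theorem nearLattice_subset (M n k : ℕ) : nearLattice C M n k ⊆ nearLattice C 0 n k := by
  intro x hx
  have hM : C.prime ^ M ∈ 𝒪[K] := pow_mem C.ϖ.2 M
  have h : C.prime ^ M * ((C.prime ^ M)⁻¹ * ((C.prime ^ n)⁻¹ * x + C.u k)) ∈ 𝒪[K] := mul_mem hM hx
  rw [mul_inv_cancel_left₀ (pow_ne_zero _ C.prime_ne_zero)] at h
  simpa [nearLattice] using h

omit [MeasurableSpace K] [BorelSpace K] in
theorem pairwise_disjoint_nearLattice (n : ℕ) :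
    Pairwise (Function.onFun Disjoint (nearLattice C 0 n)) := by
  refine fun k k' hk => Set.disjoint_left.2 fun x hx hx' => hk (C.u_inj_of_sub_mem ?_)
  have h := (𝒪[K]).sub_mem hx hx'
  simpa using h

theorem measure_nearLattice (hμ : μ (𝒪[K] : Set K) = 1) (M n k : ℕ) :
    μ (nearLattice C M n k) = ((residueCard K : ℝ≥0∞) ^ (M + n))⁻¹ := by
  have := secondCountable K
  have hpi := C.prime_ne_zero
  have h1 : nearLattice C M n k = (fun x => x + C.prime ^ n * C.u k) ⁻¹'
      ((fun x => C.prime ^ (-((M + n : ℕ) : ℤ)) * x) ⁻¹' (𝒪[K] : Set K)) := by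
    ext x
    simp only [nearLattice, Set.mem_preimage, Set.mem_ofPred_eq, SetLike.mem_coe, zpow_neg,
      zpow_natCast]
    congr! 1
    field_simp
    ring
  have h2 : MeasurableSet ((fun x => C.prime ^ (-((M + n : ℕ) : ℤ)) * x) ⁻¹' (𝒪[K] : Set K)) :=
    (measurable_const_mul _) measurableSet_integers
  rw [h1, (measurePreserving_add_right μ _).measure_preimage h2.nullMeasurableSet,
    ← (measurableEmbedding_mul_left (zpow_ne_zero _ hpi)).map_apply, map_prime_zpow_mul hμ,
    Measure.smul_apply, hμ, smul_eq_mul, mul_one, ENNReal.zpow_neg, zpow_natCast]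

theorem tendsto_mass_nearLattice (hμ : μ (𝒪[K] : Set K) = 1) (f : Lp ℂ 2 μ) (n k : ℕ) :
    Tendsto (fun M => mass f (nearLattice C M n k)) atTop (𝓝 0) := by
  refine tendsto_setLIntegral_zero ?_ ?_
  · have h : ∫⁻ x, ‖f x‖ₑ ^ 2 ∂μ = ‖f‖ₑ ^ 2 := by
      rw [← mass_univ, mass, Measure.restrict_univ]
    rw [h]; simp
  · have h : μ ∘ (fun M => nearLattice C M n k) =
        fun M => ((residueCard K : ℝ≥0∞)⁻¹) ^ (n + M) := by
      funext M
      rw [Function.comp, measure_nearLattice hμ, ENNReal.inv_pow, add_comm]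
    rw [h]
    refine (tendsto_add_atTop_iff_nat n).2 ?_ |>.congr fun M => by rw [add_comm]
    refine ENNReal.tendsto_pow_atTop_nhds_zero_of_lt_one ?_
    rw [ENNReal.inv_lt_one]
    exact_mod_cast C.one_lt_residueCard

omit [MeasurableSpace K] [BorelSpace K] in
theorem tsum_inv_pow_ne_top (C : Choices K p) :
    ∑' n : ℕ, ((residueCard K : ℝ≥0∞) ^ (n + 1))⁻¹ ≠ ∞ := by
  have h1 : (residueCard K : ℝ≥0∞)⁻¹ < 1 := by
    rw [ENNReal.inv_lt_one]
    exact_mod_cast C.one_lt_residueCard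
  simp only [ENNReal.inv_pow]
  rw [ENNReal.tsum_geometric_add_one]
  refine ENNReal.mul_ne_top h1.ne_top ?_
  rw [ne_eq, ENNReal.inv_eq_top, tsub_eq_zero_iff_le, not_le]
  exact h1

/-- The dilate of f is carried by ϖᴹ`𝒪[K]`. Cauchy–Schwarz on that set leaves the mass of a
translated dilate of ψˡ there, which is a mass of ψˡ itself on `nearLattice`. -/
theorem level_quasiAffineSystem_neg_le (hμ : μ (𝒪[K] : Set K) = 1) {f : Lp ℂ 2 μ} {R : ℕ}
    (hf : IsCarriedBy f (C.ball R)) (M n : ℕ) :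
    level (quasiAffineSystem μ C Ψ) (-((n + 1 : ℕ) : ℤ)) (dilation μ C ((R + M : ℕ) : ℤ) f) ≤
      ‖f‖ₑ ^ 2 * ∑ l, ∑' k, ((residueCard K : ℝ≥0∞) ^ (n + 1))⁻¹ *
        mass (Ψ l) (nearLattice C M (n + 1) k) := by
  have := secondCountable K
  have hn' : ¬ (0 : ℤ) ≤ -((n + 1 : ℕ) : ℤ) := by omega
  have hpi := C.prime_ne_zero
  unfold level quasiAffineSystem
  simp only [if_neg hn', inner_smul_right, enorm_mul, mul_pow, enorm_sq_rpow_half C]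
  rw [Finset.mul_sum]
  simp only [← ENNReal.tsum_mul_left]
  refine Finset.sum_le_sum fun l _ => ENNReal.tsum_le_tsum fun k => ?_
  rw [ENNReal.zpow_neg, zpow_natCast, mul_left_comm]
  refine mul_le_mul_right ?_ _
  have hE : MeasurableSet {x : K | (C.prime ^ M)⁻¹ * x ∈ 𝒪[K]} :=
    (measurable_const_mul _) measurableSet_integers
  have hc : IsCarriedBy (dilation μ C ((R + M : ℕ) : ℤ) f) {x : K | (C.prime ^ M)⁻¹ * x ∈ 𝒪[K]} := by
    filter_upwards [hf.dilation C ((R + M : ℕ) : ℤ)] with x hx hx'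
    refine hx fun h => hx' ?_
    change C.prime ^ R * (C.prime ^ (-((R + M : ℕ) : ℤ)) * x) ∈ 𝒪[K] at h
    convert h using 1
    rw [zpow_neg, zpow_natCast, pow_add]
    field_simp
  refine (enorm_inner_sq_le _ hE hc).trans (le_of_eq ?_)
  rw [enorm_dilation hμ, mass_translation_dilation hμ, zpow_neg, zpow_natCast]
  rfl

/-- Dominated convergence over (n, l, k), with the terms for M = 0 as majorant: for fixed n and l
the sets are disjoint in k, and the factors q^(-(n+1)) are summable. Each term tends to 0 because
the measure of its set does. -/
theorem tendsto_tsum_level_quasiAffineSystem (hμ : μ (𝒪[K] : Set K) = 1) {f : Lp ℂ 2 μ} {R : ℕ}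
    (hf : IsCarriedBy f (C.ball R)) :
    Tendsto (fun M : ℕ => ∑' n : ℕ, level (quasiAffineSystem μ C Ψ) (-((n + 1 : ℕ) : ℤ))
      (dilation μ C ((R + M : ℕ) : ℤ) f)) atTop (𝓝 0) := by
  let F : ℕ → ℕ × Fin L × ℕ → ℝ≥0∞ := fun M i =>
    ((residueCard K : ℝ≥0∞) ^ (i.1 + 1))⁻¹ * mass (Ψ i.2.1) (nearLattice C M (i.1 + 1) i.2.2)
  have h1 : Tendsto (fun M => ∑' i, F M i) atTop (𝓝 0) := by
    refine tendsto_tsum_zero_of_dominated (F 0) (fun M i => ?_) ?_ fun i => ?_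
    · exact mul_le_mul_right (lintegral_mono_set (nearLattice_subset _ _ _)) _
    · have h2 : ∑' i, F 0 i ≤ ∑' n : ℕ, ((residueCard K : ℝ≥0∞) ^ (n + 1))⁻¹ *
          ∑ l, ‖Ψ l‖ₑ ^ 2 := by
        rw [ENNReal.tsum_prod']
        refine ENNReal.tsum_le_tsum fun n => ?_
        rw [ENNReal.tsum_prod', tsum_fintype, Finset.mul_sum]
        refine Finset.sum_le_sum fun l _ => ?_
        simp only [F]
        rw [ENNReal.tsum_mul_left]
        gcongr
        exact tsum_mass_le _ (fun k => measurableSet_nearLattice _ _ _)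
          (pairwise_disjoint_nearLattice _)
      refine ne_top_of_le_ne_top ?_ h2
      rw [ENNReal.tsum_mul_right]
      exact ENNReal.mul_ne_top (tsum_inv_pow_ne_top C)
        (ENNReal.sum_ne_top.2 fun l _ => by simp)
    · have h2 := ENNReal.Tendsto.const_mul
        (tendsto_mass_nearLattice (C := C) hμ (Ψ i.2.1) (i.1 + 1) i.2.2)
        (Or.inr (ENNReal.inv_ne_top.2 (pow_ne_zero (i.1 + 1) C.cast_residueCard_ne_zero)))
      rwa [mul_zero] at h2
  have h2 := ENNReal.Tendsto.const_mul (a := ‖f‖ₑ ^ 2) h1 (Or.inr (by simp))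
  rw [mul_zero] at h2
  refine tendsto_of_tendsto_of_tendsto_of_le_of_le tendsto_const_nhds h2 (fun _ => zero_le)
    fun M => ?_
  refine (ENNReal.tsum_le_tsum fun n => level_quasiAffineSystem_neg_le hμ hf M n).trans
    (le_of_eq ?_)
  rw [ENNReal.tsum_mul_left, ENNReal.tsum_prod']
  simp only [ENNReal.tsum_prod', tsum_fintype, F]

theorem hasLowerBound_affineSystem (hμ : μ (𝒪[K] : Set K) = 1) {A B : ℝ≥0}
    (hB : HasUpperBound (affineSystem μ C Ψ) B) (hA : HasLowerBound (quasiAffineSystem μ C Ψ) A) :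
    HasLowerBound (affineSystem μ C Ψ) A := by
  refine hB.hasLowerBound_of_dense (dense_setOf_isCarriedBy_ball μ C) ?_
  rintro f ⟨R, hf⟩
  have h1 := (tendsto_tsum_level_quasiAffineSystem (Ψ := Ψ) hμ hf).const_add
    (frameSum (affineSystem μ C Ψ) f)
  rw [add_zero] at h1
  refine ge_of_tendsto' h1 fun M => ?_
  have h2 := hA (dilation μ C ((R + M : ℕ) : ℤ) f)
  rw [enorm_dilation hμ, frameSum_eq_tsum_level, tsum_int_eq_tsum_add_tsum _ 0] at h2
  refine h2.trans (add_le_add ?_ (le_of_eq ?_))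
  -- The nonnegative quasi-affine scales are affine ones, and the full affine sum does not see the
  -- dilation.
  · rw [← frameSum_affineSystem_dilation hμ ((R + M : ℕ) : ℤ) f, frameSum_eq_tsum_level]
    refine le_trans (le_of_eq (tsum_congr fun n => ?_)) (tsum_nat_le_tsum_int _ 0)
    exact level_quasiAffineSystem_of_nonneg C Ψ (by simp) _
  · refine tsum_congr fun n => ?_
    rw [zero_add, add_comm 1 n]

/-! ### The large scales of the affine functional -/

variable (C) in
/-- The set of `x` with `ϖ⁻ˢ (x + u k) + u b ∈ 𝒪`. -/
def affineCell (b s k : ℕ) : Set K :=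
  {x | (C.prime ^ s)⁻¹ * (x + C.u k) + C.u b ∈ 𝒪[K]}

theorem measurableSet_affineCell (b s k : ℕ) : MeasurableSet (affineCell C b s k) :=
  have := secondCountable K
  (by fun_prop : Measurable fun x : K => (C.prime ^ s)⁻¹ * (x + C.u k) + C.u b)
    measurableSet_integers

omit [MeasurableSpace K] [BorelSpace K] in
-- As |u(b)| > 1 while the sum in `affineCell` is integral, both summands have the same valuation.
-- Hence |x + u(k)| and t determine s.
theorem valuation_of_mem_affineCell {b s k t : ℕ} (ht : t ≠ 0)
    (hb : valuation K (C.u b) = (valuation K C.prime ^ t)⁻¹) {x : K}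
    (hx : x ∈ affineCell C b s k) :
    valuation K (x + C.u k) * valuation K C.prime ^ t = valuation K C.prime ^ s := by
  have hpos := C.valuation_prime_pos
  have h1 : valuation K ((C.prime ^ s)⁻¹ * (x + C.u k)) = (valuation K C.prime ^ t)⁻¹ := by
    rw [← hb, ← Valuation.map_neg _ (C.u b)]
    have h2 : (C.prime ^ s)⁻¹ * (x + C.u k) =
        ((C.prime ^ s)⁻¹ * (x + C.u k) + C.u b) + -C.u b := by ring
    rw [h2]
    refine (valuation K).map_add_eq_of_lt_right ?_
    rw [Valuation.map_neg, hb]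
    have h3 : 1 < (valuation K C.prime ^ t)⁻¹ := (one_lt_inv₀ (pow_pos hpos _)).2
      (pow_lt_one₀ hpos.le C.valuation_prime_lt_one ht)
    exact lt_of_le_of_lt hx h3
  rw [map_mul, map_inv₀, map_pow] at h1
  have hs := (pow_pos hpos s).ne'
  have ht' := (pow_pos hpos t).ne'
  field_simp at h1
  exact h1

omit [MeasurableSpace K] [BorelSpace K] in
-- A point x of a cell recovers its indices in turn. Since t ≤ M, x + u(k) is integral, which fixes
-- k; its valuation fixes the scale; integrality of the defining expression then fixes b.
theorem pairwise_disjoint_affineCell {t M : ℕ} (ht : t ≠ 0) (htM : t ≤ M) :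
    Pairwise (Function.onFun Disjoint
      fun i : {b : ℕ // valuation K (C.u b) = (valuation K C.prime ^ t)⁻¹} × ℕ × ℕ =>
        affineCell C i.1 (M + 1 + i.2.1) i.2.2) := by
  rintro ⟨⟨b, hb⟩, n, k⟩ ⟨⟨b', hb'⟩, n', k'⟩ hne
  refine Set.disjoint_left.2 fun x hx hx' => hne ?_
  have hpos := C.valuation_prime_pos
  have hlt := C.valuation_prime_lt_one
  have h1 := valuation_of_mem_affineCell ht hb hx
  have h2 := valuation_of_mem_affineCell ht hb' hx'
  have key : ∀ s k, valuation K (x + C.u k) * valuation K C.prime ^ t =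
      valuation K C.prime ^ (M + 1 + s) → x + C.u k ∈ 𝒪[K] := by
    intro s k h
    have h3 : valuation K C.prime ^ (M + 1 + s) ≤ 1 * valuation K C.prime ^ t := by
      rw [one_mul]
      exact pow_le_pow_right_of_le_one' hlt.le (by omega)
    rw [← h] at h3
    exact le_of_mul_le_mul_right h3 (pow_pos hpos t)
  obtain rfl : k = k' := by
    refine C.u_inj_of_sub_mem ?_
    have h := (𝒪[K]).sub_mem (key _ _ h1) (key _ _ h2)
    simpa using h
  obtain rfl : n = n' := by
    have h := (pow_right_strictAnti₀ hpos hlt).injective (h1.symm.trans h2)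
    exact Nat.add_left_cancel h
  obtain rfl : b = b' := by
    refine C.u_inj_of_sub_mem ?_
    have h := (𝒪[K]).sub_mem hx hx'
    simpa using h
  rfl

theorem level_affineSystem_neg_le (hμ : μ (𝒪[K] : Set K) = 1) {f : Lp ℂ 2 μ} {R : ℕ}
    (hf : IsCarriedBy f (C.ball R)) (b s : ℕ) :
    level (affineSystem μ C Ψ) (-((R + s : ℕ) : ℤ))
        (translation μ (-((C.prime ^ R)⁻¹ * C.u b)) f) ≤
      ‖f‖ₑ ^ 2 * ∑ l, ∑' k, mass (Ψ l) (affineCell C b s k) := by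
  have := secondCountable K
  have hpi := C.prime_ne_zero
  unfold level affineSystem
  rw [Finset.mul_sum]
  simp only [← ENNReal.tsum_mul_left]
  gcongr with l _ k
  have hE : MeasurableSet {x : K | x - -((C.prime ^ R)⁻¹ * C.u b) ∈ C.ball R} :=
    (measurable_sub_const _) (C.measurableSet_ball R)
  refine (enorm_inner_sq_le _ hE (hf.translation _)).trans (le_of_eq ?_)
  rw [enorm_translation, mass_dilation_translation hμ, zpow_neg, zpow_natCast]
  congr 2
  ext x
  simp only [affineCell, Choices.ball, Set.mem_ofPred_eq]
  congr! 1
  rw [pow_add]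
  field_simp
  ring

/-- By disjointness of the cells, a whole shell |u(b)| = |ϖ|⁻ᵗ costs, over all scales below -(R+M),
a bound independent of t and M. -/
theorem tsum_level_affineSystem_le (hμ : μ (𝒪[K] : Set K) = 1) {f : Lp ℂ 2 μ} {R t M : ℕ}
    (hf : IsCarriedBy f (C.ball R)) (ht : t ≠ 0) (htM : t ≤ M) :
    ∑' b : {b : ℕ // valuation K (C.u b) = (valuation K C.prime ^ t)⁻¹}, ∑' n : ℕ,
        level (affineSystem μ C Ψ) (-((R + M + 1 + n : ℕ) : ℤ))
          (translation μ (-((C.prime ^ R)⁻¹ * C.u b)) f) ≤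
      ‖f‖ₑ ^ 2 * ∑ l, ‖Ψ l‖ₑ ^ 2 := by
  calc _ ≤ ∑' b : {b : ℕ // valuation K (C.u b) = (valuation K C.prime ^ t)⁻¹}, ∑' n : ℕ,
        ‖f‖ₑ ^ 2 * ∑ l, ∑' k, mass (Ψ l) (affineCell C b (M + 1 + n) k) := by
        refine ENNReal.tsum_le_tsum fun b => ENNReal.tsum_le_tsum fun n => ?_
        have h := level_affineSystem_neg_le (Ψ := Ψ) hμ hf b (M + 1 + n)
        rwa [← add_assoc, ← add_assoc] at h
    _ = ‖f‖ₑ ^ 2 * ∑ l, ∑' i : {b : ℕ // valuation K (C.u b) = (valuation K C.prime ^ t)⁻¹} ×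
          ℕ × ℕ, mass (Ψ l) (affineCell C i.1 (M + 1 + i.2.1) i.2.2) := by
        simp only [ENNReal.tsum_mul_left, ENNReal.tsum_prod']
        simp only [Summable.tsum_finsetSum fun _ _ => ENNReal.summable]
    _ ≤ _ := by
        gcongr with l _
        exact tsum_mass_le _ (fun i => measurableSet_affineCell _ _ _)
          (pairwise_disjoint_affineCell ht htM)

omit [MeasurableSpace K] [BorelSpace K] in
theorem sum_range_le_of_valuation (F : ℕ → ℝ≥0∞) (M : ℕ) :
    ∑ b ∈ Finset.range (residueCard K ^ M), F b ≤ F 0 + ∑ t ∈ Finset.Icc 1 M,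
      ∑' b : {b : ℕ // valuation K (C.u b) = (valuation K C.prime ^ t)⁻¹}, F b := by
  classical
  let S : ℕ → Set ℕ := fun t => {b | valuation K (C.u b) = (valuation K C.prime ^ t)⁻¹}
  have h1 : ∀ b ∈ Finset.range (residueCard K ^ M),
      F b ≤ ({0} : Set ℕ).indicator F b + ∑ t ∈ Finset.Icc 1 M, (S t).indicator F b := by
    intro b hb
    rcases eq_or_ne b 0 with rfl | h0
    · simp
    obtain ⟨t, ht, hv⟩ := C.exists_valuation_u (Finset.mem_range.1 hb) h0
    refine le_add_left (le_trans ?_ (Finset.single_le_sum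
      (f := fun t => (S t).indicator F b) (fun _ _ => zero_le) ht))
    rw [Set.indicator_of_mem (by exact hv)]
  refine (Finset.sum_le_sum h1).trans ?_
  rw [Finset.sum_add_distrib, Finset.sum_comm]
  refine add_le_add ((ENNReal.sum_le_tsum _).trans (le_of_eq ?_))
    (Finset.sum_le_sum fun t _ => (ENNReal.sum_le_tsum _).trans (le_of_eq ?_))
  · rw [← tsum_subtype, tsum_singleton]
  · exact (tsum_subtype (S t) F).symm

/-- The cells for b = 0 are nested in the scale rather than disjoint, so this term is left to the
Bessel bound B. Each of the M shells contributes ∑ ‖ψˡ‖², and the growth is linear in M. -/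
theorem sum_tsum_level_affineSystem_le (hμ : μ (𝒪[K] : Set K) = 1) {B : ℝ≥0}
    (hB : HasUpperBound (affineSystem μ C Ψ) B) {f : Lp ℂ 2 μ} {R : ℕ}
    (hf : IsCarriedBy f (C.ball R)) (M : ℕ) :
    ∑ b ∈ Finset.range (residueCard K ^ M), ∑' n : ℕ,
        level (affineSystem μ C Ψ) (-((R + M + 1 + n : ℕ) : ℤ))
          (translation μ (-((C.prime ^ R)⁻¹ * C.u b)) f) ≤
      ‖f‖ₑ ^ 2 * (B + M * ∑ l, ‖Ψ l‖ₑ ^ 2) := by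
  refine (sum_range_le_of_valuation (C := C) _ M).trans ?_
  rw [mul_add]
  refine add_le_add ?_ ?_
  · rw [C.u_zero, mul_zero, neg_zero, translation_zero, mul_comm]
    refine le_trans ?_ (hB f)
    rw [frameSum_eq_tsum_level]
    exact tsum_neg_le_tsum_int (fun j => level (affineSystem μ C Ψ) j f) (R + M)
  · refine (Finset.sum_le_sum fun t ht => tsum_level_affineSystem_le hμ hf
      (by rw [Finset.mem_Icc] at ht; omega) (Finset.mem_Icc.1 ht).2).trans (le_of_eq ?_)
    rw [Finset.sum_const, Nat.card_Icc, nsmul_eq_mul, add_tsub_cancel_right]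
    ring

theorem average_tsum_level_affineSystem_le (hμ : μ (𝒪[K] : Set K) = 1) {B : ℝ≥0}
    (hB : HasUpperBound (affineSystem μ C Ψ) B) {f : Lp ℂ 2 μ} {R : ℕ}
    (hf : IsCarriedBy f (C.ball R)) (M : ℕ) :
    ((residueCard K : ℝ≥0∞) ^ (R + M))⁻¹ * ∑ a ∈ Finset.range (residueCard K ^ (R + M)),
        ∑' n : ℕ, level (affineSystem μ C Ψ) (-((R + M + 1 + n : ℕ) : ℤ))
          (translation μ (-C.u a) f) ≤
      ‖f‖ₑ ^ 2 * (((residueCard K : ℝ≥0∞) ^ M)⁻¹ * (B + M * ∑ l, ‖Ψ l‖ₑ ^ 2)) := by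
  have hq := C.cast_residueCard_ne_zero
  have hq' : (residueCard K : ℝ≥0∞) ≠ ∞ := ENNReal.natCast_ne_top _
  rw [Choices.sum_range_pow_add]
  have h1 : ∀ a ∈ Finset.range (residueCard K ^ R),
      ∑ b ∈ Finset.range (residueCard K ^ M),
        ∑' n : ℕ, level (affineSystem μ C Ψ) (-((R + M + 1 + n : ℕ) : ℤ))
          (translation μ (-C.u (a + residueCard K ^ R * b)) f) ≤
      ‖f‖ₑ ^ 2 * (B + M * ∑ l, ‖Ψ l‖ₑ ^ 2) := by
    intro a ha
    rw [Finset.mem_range] at ha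
    -- For a < q^R the point u(a) lies in the ball of radius index R, so translating f by -u(a)
    -- keeps it carried by that ball.
    have h := sum_tsum_level_affineSystem_le hμ hB
      (hf.translation_ball ((C.mem_ball_iff R _).2 (C.valuation_u_le ha))) M
    rw [enorm_translation] at h
    refine le_trans (le_of_eq ?_) h
    refine Finset.sum_congr rfl fun b _ => tsum_congr fun n => ?_
    rw [translation_translation, C.u_add_pow_mul R ha, neg_add_rev]
  refine (mul_le_mul_right (Finset.sum_le_sum h1) _).trans (le_of_eq ?_)
  rw [Finset.sum_const, Finset.card_range, nsmul_eq_mul, Nat.cast_pow, add_comm R M, pow_add,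
    ENNReal.mul_inv (by simp [hq]) (by simp [hq']), mul_assoc,
    ENNReal.inv_mul_cancel_left' (by simp [hq]) (by simp [hq']), mul_left_comm]

/-- The affine lower bound is averaged over the translates by -u(a), a < q^(R+M): scales from -(R+M)
upwards average to quasi-affine ones, and the rest is O(M q⁻ᴹ). -/
theorem hasLowerBound_quasiAffineSystem (hμ : μ (𝒪[K] : Set K) = 1) {A B : ℝ≥0}
    (hB : HasUpperBound (affineSystem μ C Ψ) B) (hA : HasLowerBound (affineSystem μ C Ψ) A) :
    HasLowerBound (quasiAffineSystem μ C Ψ) A := by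
  have hq := C.cast_residueCard_ne_zero
  have hq' : (residueCard K : ℝ≥0∞) ≠ ∞ := ENNReal.natCast_ne_top _
  refine (hasUpperBound_quasiAffineSystem hB).hasLowerBound_of_dense
    (dense_setOf_isCarriedBy_ball μ C) ?_
  rintro f ⟨R, hf⟩
  have h0 := tendsto_inv_pow_mul_add_mul C.one_lt_residueCard (a := (B : ℝ≥0∞))
    (b := ∑ l, ‖Ψ l‖ₑ ^ 2) (by simp) (ENNReal.sum_ne_top.2 fun l _ => by simp)
  have h1 := (ENNReal.Tendsto.const_mul (a := ‖f‖ₑ ^ 2) h0 (Or.inr (by simp))).const_add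
    (frameSum (quasiAffineSystem μ C Ψ) f)
  rw [mul_zero, add_zero] at h1
  refine ge_of_tendsto' h1 fun M => ?_
  calc (A : ℝ≥0∞) * ‖f‖ₑ ^ 2
      = ((residueCard K : ℝ≥0∞) ^ (R + M))⁻¹ * ∑ a ∈ Finset.range (residueCard K ^ (R + M)),
          (A : ℝ≥0∞) * ‖translation μ (-C.u a) f‖ₑ ^ 2 := by
        simp only [enorm_translation]
        rw [Finset.sum_const, Finset.card_range, nsmul_eq_mul, Nat.cast_pow,
          ENNReal.inv_mul_cancel_left' (by simp [hq]) (by simp [hq'])]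
    _ ≤ ((residueCard K : ℝ≥0∞) ^ (R + M))⁻¹ * ∑ a ∈ Finset.range (residueCard K ^ (R + M)),
          frameSum (affineSystem μ C Ψ) (translation μ (-C.u a) f) := by
        gcongr with a _
        exact hA _
    _ = ∑' n : ℕ, level (quasiAffineSystem μ C Ψ) (n - (R + M : ℕ)) f +
          ((residueCard K : ℝ≥0∞) ^ (R + M))⁻¹ * ∑ a ∈ Finset.range (residueCard K ^ (R + M)),
            ∑' n : ℕ, level (affineSystem μ C Ψ) (-((R + M + 1 + n : ℕ) : ℤ))
              (translation μ (-C.u a) f) := by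
        simp only [frameSum_eq_tsum_level, fun g : Lp ℂ 2 μ => tsum_int_eq_tsum_add_tsum
          (fun j => level (affineSystem μ C Ψ) j g) (R + M)]
        rw [Finset.sum_add_distrib, mul_add,
          ← Summable.tsum_finsetSum fun _ _ => ENNReal.summable, ← ENNReal.tsum_mul_left]
        congr 1
        refine tsum_congr fun n => ?_
        exact average_level_affineSystem C Ψ (by omega) f
    _ ≤ _ := by
        refine add_le_add ?_ (average_tsum_level_affineSystem_le hμ hB hf M)
        rw [frameSum_eq_tsum_level]
        exact tsum_nat_le_tsum_int (fun j => level (quasiAffineSystem μ C Ψ) j f) (R + M)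

omit [μ.IsAddHaarMeasure] in
theorem nontrivial_Lp (hμ : μ (𝒪[K] : Set K) = 1) : Nontrivial (Lp ℂ 2 μ) := by
  refine ⟨indicatorConstLp 2 measurableSet_integers (by rw [hμ]; simp) (1 : ℂ), 0, fun h => ?_⟩
  have h1 := congrArg norm h
  rw [norm_indicatorConstLp (by norm_num) (by norm_num), measureReal_def, hμ] at h1
  simp at h1

end LowerBounds

end LocalFieldFrames

end

theorem theorem3p3 {K : Type*} [Field K] [ValuativeRel K] [TopologicalSpace K]
    [IsNonarchimedeanLocalField K] {p : ℕ} [Fact p.Prime] [CharP K p]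
    [MeasurableSpace K] [BorelSpace K] (μ : Measure K) [μ.IsAddHaarMeasure]
    (hμ : μ (𝒪[K] : Set K) = 1) (C : LocalFieldFrames.Choices K p)
    {L : ℕ} (Ψ : Fin L → Lp ℂ 2 μ) :
    ((LocalFieldFrames.IsBesselFamily (LocalFieldFrames.affineSystem μ C Ψ) ↔
        LocalFieldFrames.IsBesselFamily (LocalFieldFrames.quasiAffineSystem μ C Ψ)) ∧
      (LocalFieldFrames.IsBesselFamily (LocalFieldFrames.affineSystem μ C Ψ) →
        ∃ B : ℝ≥0,
          LocalFieldFrames.IsOptimalUpperBound (LocalFieldFrames.affineSystem μ C Ψ) B ∧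
          LocalFieldFrames.IsOptimalUpperBound (LocalFieldFrames.quasiAffineSystem μ C Ψ) B)) ∧
    ((LocalFieldFrames.IsFrame (LocalFieldFrames.affineSystem μ C Ψ) ↔
        LocalFieldFrames.IsFrame (LocalFieldFrames.quasiAffineSystem μ C Ψ)) ∧
      (LocalFieldFrames.IsFrame (LocalFieldFrames.affineSystem μ C Ψ) →
        ∃ A B : ℝ≥0,
          LocalFieldFrames.IsOptimalLowerBound (LocalFieldFrames.affineSystem μ C Ψ) A ∧
          LocalFieldFrames.IsOptimalLowerBound (LocalFieldFrames.quasiAffineSystem μ C Ψ) A ∧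
          LocalFieldFrames.IsOptimalUpperBound (LocalFieldFrames.affineSystem μ C Ψ) B ∧
          LocalFieldFrames.IsOptimalUpperBound (LocalFieldFrames.quasiAffineSystem μ C Ψ) B)) := by
  have := LocalFieldFrames.nontrivial_Lp hμ
  have hup : ∀ B, LocalFieldFrames.HasUpperBound (LocalFieldFrames.affineSystem μ C Ψ) B ↔
      LocalFieldFrames.HasUpperBound (LocalFieldFrames.quasiAffineSystem μ C Ψ) B := fun B =>
    ⟨LocalFieldFrames.hasUpperBound_quasiAffineSystem,
      LocalFieldFrames.hasUpperBound_affineSystem hμ⟩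
  -- Both directions for lower bounds use the Bessel bound, to pass from functions carried by balls
  -- to all of L².
  have hlow : LocalFieldFrames.IsBesselFamily (LocalFieldFrames.affineSystem μ C Ψ) →
      ∀ A, LocalFieldFrames.HasLowerBound (LocalFieldFrames.affineSystem μ C Ψ) A ↔
        LocalFieldFrames.HasLowerBound (LocalFieldFrames.quasiAffineSystem μ C Ψ) A := by
    rintro ⟨B, -, hB⟩ A
    exact ⟨LocalFieldFrames.hasLowerBound_quasiAffineSystem hμ hB,
      LocalFieldFrames.hasLowerBound_affineSystem hμ hB⟩
  have hbes : LocalFieldFrames.IsBesselFamily (LocalFieldFrames.affineSystem μ C Ψ) ↔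
      LocalFieldFrames.IsBesselFamily (LocalFieldFrames.quasiAffineSystem μ C Ψ) :=
    exists_congr fun B => and_congr_right fun _ => hup B
  have hopt : LocalFieldFrames.IsBesselFamily (LocalFieldFrames.affineSystem μ C Ψ) → ∃ B : ℝ≥0,
      LocalFieldFrames.IsOptimalUpperBound (LocalFieldFrames.affineSystem μ C Ψ) B ∧
        LocalFieldFrames.IsOptimalUpperBound (LocalFieldFrames.quasiAffineSystem μ C Ψ) B := by
    intro h
    obtain ⟨B, hB⟩ := h.exists_isOptimalUpperBound
    refine ⟨B, hB, ?_⟩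
    simpa only [LocalFieldFrames.IsOptimalUpperBound, hup] using hB
  refine ⟨⟨hbes, hopt⟩, ⟨fun h => ?_, fun h => ?_⟩, fun h => ?_⟩
  · have hl := hlow h.isBesselFamily
    obtain ⟨A, B, hA, hAB, h1, h2⟩ := h
    exact ⟨A, B, hA, hAB, (hl A).1 h1, (hup B).1 h2⟩
  · have hl := hlow (hbes.2 h.isBesselFamily)
    obtain ⟨A, B, hA, hAB, h1, h2⟩ := h
    exact ⟨A, B, hA, hAB, (hl A).2 h1, (hup B).2 h2⟩
  · have hl := hlow h.isBesselFamily
    obtain ⟨A, hA⟩ := h.isBesselFamily.exists_isOptimalLowerBound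
    obtain ⟨B, hB, hB'⟩ := hopt h.isBesselFamily
    refine ⟨A, B, hA, ?_, hB, hB'⟩
    simpa only [LocalFieldFrames.IsOptimalLowerBound, hl] using hA
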